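/- Let $M$ be a 4-dimensional compact oriented smooth manifold without boundary and let $f_1,f_2\in C^\infty(M)$ be real-valued. For a Riemannian metric $g$ on $M$ put $$A_4(f_1,f_2)_g=\tfrac13\, r\,\langle df_1,df_2\rangle+\Delta\langle df_1,df_2\rangle+\langle\nabla df_1,\nabla df_2\rangle-\tfrac12\,\Delta f_1\,\Delta f_2,$$ where $\nabla$ is the Levi-Civita connection of $g$, $\langle\cdot,\cdot\rangle$ is the inner product induced by $g$ on tensors, $r$ is the scalar curvature of $g$ (positive on round spheres), and $\Delta=-\sum_{i,j}g^{ij}\bigl(\partial_i\partial_j-\sum_k\Gamma^k_{ij}\partial_k\bigr)$ is the (nonnegative) Laplacian of $g$. Let $\bar g,\bar{\bar g}$ be smooth Riemannian metrics on $M$. Then at every point of $M$ the function $\varepsilon\mapsto A_4(f_1,f_2)_{\bar g+\varepsilon\bar{\bar g}}$ is the sum, for all sufficiently small $|\varepsilon|$, of its Taylor series at $\varepsilon=0$, $$A_4(f_1,f_2)_{\bar g+\varepsilon\bar{\bar g}}=\sum_{m\ge0}A_4^m(f_1,f_2)_{(\bar g,\bar{\bar g})}\,\varepsilon^m,$$ and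 for every $m\ge 0$ and every $f\in C^\infty(M)$ with $f>0$, $$A_4^m(f_1,f_2)_{(f\bar g,f\bar{\bar g})}=f^{-2}\,A_4^m(f_1,f_2)_{(\bar g,\bar{\bar g})}.$$ Consequently the 4-forms $B^m(f_1,f_2)_{(\bar g,\bar{\bar g})}:=A_4^m(f_1,f_2)_{(\bar g,\bar{\bar g})}\,\mathrm{Vol}_{M,\bar g}$ are bimetric conformal invariants, that is, $$B^m(f_1,f_2)_{(f\bar g,f\bar{\bar g})}=B^m(f_1,f_2)_{(\bar g,\bar{\bar g})}$$ for all Riemannian metrics $\bar g,\bar{\bar g}$, all smooth $f>0$ and all $m\ge0$. -/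

import Mathlib

open scoped Manifold ContDiff

namespace BimetricConformal

noncomputable section

/-- The model space `ℝ⁴`. -/
abbrev E4 : Type := EuclideanSpace ℝ (Fin 4)

/-! ### Local formulas: tensor calculus in an open subset of `ℝ⁴`

`G y i j` are the components `g_{ij}(y)` of a metric, and `u`, `v` are functions. -/

/-- The partial derivative `∂_i h` at `y`. -/
def pderiv (i : Fin 4) (h : E4 → ℝ) (y : E4) : ℝ :=
  fderiv ℝ h y (EuclideanSpace.single i 1)

/-- Christoffel symbols
`Γ^k_{ij} = ½ ∑_l g^{kl} (∂_j g_{il} + ∂_i g_{jl} - ∂_l g_{ij})`. -/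
def christoffel (G : E4 → Matrix (Fin 4) (Fin 4) ℝ) (k i j : Fin 4) (y : E4) : ℝ :=
  (1 / 2) * ∑ l, (G y)⁻¹ k l *
    (pderiv j (fun z => G z i l) y + pderiv i (fun z => G z j l) y
      - pderiv l (fun z => G z i j) y)

/-- The components `R^a_{l j k}` of the curvature tensor, that is
`R(∂_j, ∂_k) ∂_l = ∑_a R^a_{l j k} ∂_a` with
`R(X, Y) = ∇_X ∇_Y - ∇_Y ∇_X - ∇_{[X, Y]}`. -/
def riemann (G : E4 → Matrix (Fin 4) (Fin 4) ℝ) (a l j k : Fin 4) (y : E4) : ℝ :=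
  pderiv j (christoffel G a k l) y - pderiv k (christoffel G a j l) y
    + ∑ b, (christoffel G a j b y * christoffel G b k l y
        - christoffel G a k b y * christoffel G b j l y)

/-- The scalar curvature `r = ∑ g^{jl} R^k_{l k j}` (positive on round spheres). -/
def scalarCurvature (G : E4 → Matrix (Fin 4) (Fin 4) ℝ) (y : E4) : ℝ :=
  ∑ j, ∑ l, (G y)⁻¹ j l * ∑ k, riemann G k l k j y

/-- The pairing of differentials `⟨du, dv⟩ = ∑ g^{jl} ∂_j u ∂_l v`. -/
def gradInner (G : E4 → Matrix (Fin 4) (Fin 4) ℝ) (u v : E4 → ℝ) (y : E4) : ℝ :=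
  ∑ j, ∑ l, (G y)⁻¹ j l * pderiv j u y * pderiv l v y

/-- The components `∂_i ∂_j u - ∑_k Γ^k_{ij} ∂_k u` of the covariant derivative `∇ du`. -/
def hessian (G : E4 → Matrix (Fin 4) (Fin 4) ℝ) (u : E4 → ℝ) (i j : Fin 4) (y : E4) : ℝ :=
  pderiv i (pderiv j u) y - ∑ k, christoffel G k i j y * pderiv k u y

/-- The Laplacian `Δ u = - ∑ g^{ij} (∂_i ∂_j u - ∑_k Γ^k_{ij} ∂_k u)`. -/
def laplacian (G : E4 → Matrix (Fin 4) (Fin 4) ℝ) (u : E4 → ℝ) (y : E4) : ℝ :=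
  -∑ i, ∑ j, (G y)⁻¹ i j * hessian G u i j y

/-- The pairing `⟨∇ du, ∇ dv⟩` of covariant 2-tensors. -/
def hessianInner (G : E4 → Matrix (Fin 4) (Fin 4) ℝ) (u v : E4 → ℝ) (y : E4) : ℝ :=
  ∑ i, ∑ j, ∑ p, ∑ q,
    (G y)⁻¹ i p * (G y)⁻¹ j q * hessian G u i j y * hessian G v p q y

/-- The local expression
`⅓ r ⟨du, dv⟩ + Δ⟨du, dv⟩ + ⟨∇du, ∇dv⟩ - ½ Δu Δv`. -/
def localConnesDensity (G : E4 → Matrix (Fin 4) (Fin 4) ℝ) (u v : E4 → ℝ) (y : E4) : ℝ :=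
  (1 / 3) * scalarCurvature G y * gradInner G u v y
    + laplacian G (gradInner G u v) y
    + hessianInner G u v y
    - (1 / 2) * (laplacian G u y * laplacian G v y)

/-! ### Metrics on a 4-manifold -/

section Manifold

variable (M : Type*) [TopologicalSpace M] [ChartedSpace E4 M]

/-- Fields of bilinear forms on the tangent spaces (covariant 2-tensors). -/
abbrev BilinField : Type _ :=
  ∀ x : M, TangentSpace (𝓡 4) x →L[ℝ] TangentSpace (𝓡 4) x →L[ℝ] ℝ

/-- Smooth Riemannian metrics on `M`. -/
abbrev RMetric [IsManifold (𝓡 4) ∞ M] : Type _ :=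
  Bundle.ContMDiffRiemannianMetric (𝓡 4) ∞ E4 (fun x : M => TangentSpace (𝓡 4) x)

/-- An orientation of the manifold `M`: an orientation of every tangent space, locally constant
when read in the coordinates around any point. -/
structure ManifoldOrientation [IsManifold (𝓡 4) ∞ M] where
  /-- the orientation of the tangent space at `x` -/
  orient (x : M) : Orientation ℝ (TangentSpace (𝓡 4) x) (Fin 4)
  locally_constant : ∀ x : M, ∀ᶠ y in nhds x,
    ∃ hy : y ∈ (trivializationAt E4 (TangentSpace (𝓡 4) : M → Type) x).baseSet,
      Orientation.map (Fin 4)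
          ((trivializationAt E4 (TangentSpace (𝓡 4) : M → Type) x).continuousLinearEquivAt
            ℝ y hy).toLinearEquiv (orient y)
        = Orientation.map (Fin 4)
          ((trivializationAt E4 (TangentSpace (𝓡 4) : M → Type) x).continuousLinearEquivAt
            ℝ x (FiberBundle.mem_baseSet_trivializationAt' x)).toLinearEquiv (orient x)

variable {M}

/-- The `i`-th coordinate vector field `∂_i` of the chart around `x`, at the point with
coordinates `y`. -/
def coordVector (x : M) (i : Fin 4) (y : E4) :
    TangentSpace (𝓡 4) ((extChartAt (𝓡 4) x).symm y) :=
  mfderiv 𝓘(ℝ, E4) (𝓡 4) (extChartAt (𝓡 4) x).symm y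
    (EuclideanSpace.single i 1 : E4)

/-- The components `g_{ij} = g(∂_i, ∂_j)` in the chart around `x`. -/
def metricCoeff (g : BilinField M) (x : M) (y : E4) : Matrix (Fin 4) (Fin 4) ℝ :=
  Matrix.of fun i j =>
    g ((extChartAt (𝓡 4) x).symm y) (coordVector x i y) (coordVector x j y)

/-- Connes' density
`A₄(f₁, f₂)_g = ⅓ r ⟨df₁, df₂⟩ + Δ⟨df₁, df₂⟩ + ⟨∇df₁, ∇df₂⟩ - ½ Δf₁ Δf₂` at `x`, computed in
local coordinates around `x`. -/
def connesDensity (g : BilinField M) (f₁ f₂ : M → ℝ) (x : M) : ℝ :=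
  localConnesDensity (metricCoeff g x)
    (fun y => f₁ ((extChartAt (𝓡 4) x).symm y))
    (fun y => f₂ ((extChartAt (𝓡 4) x).symm y))
    (extChartAt (𝓡 4) x x)

variable [IsManifold (𝓡 4) ∞ M]

/-- The linear perturbation `g₀ + ε g₁`. -/
def perturb (g₀ g₁ : RMetric M) (ε : ℝ) : BilinField M :=
  fun x => g₀.inner x + ε • g₁.inner x

/-- The Taylor coefficient `A₄^m(f₁, f₂)_{(g₀, g₁)}`: the coefficient of `ε ^ m` in the Taylor
expansion at `ε = 0` of `A₄(f₁, f₂)` for the metric `g₀ + ε g₁`. -/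
def connesCoeff (m : ℕ) (g₀ g₁ : RMetric M) (f₁ f₂ : M → ℝ) (x : M) : ℝ :=
  iteratedDeriv m (fun ε : ℝ => connesDensity (perturb g₀ g₁ ε) f₁ f₂ x) 0 / (m.factorial : ℝ)

/-- A basis of the tangent space at `x` that is positive for the given orientation. -/
def orientedBasis (o : ManifoldOrientation M) (x : M) :
    Module.Basis (Fin 4) ℝ (TangentSpace (𝓡 4) x) :=
  Module.Basis.adjustToOrientation
    (show Module.Basis (Fin 4) ℝ (TangentSpace (𝓡 4) x) from
      (EuclideanSpace.basisFun (Fin 4) ℝ).toBasis) (o.orient x)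

/-- The Riemannian volume form
`√(det g(b_i, b_j)) b₁* ∧ b₂* ∧ b₃* ∧ b₄*`, for a positive basis `b` of the tangent space. -/
def volumeForm (o : ManifoldOrientation M) (g : RMetric M) (x : M) :
    (TangentSpace (𝓡 4) x) [⋀^Fin 4]→ₗ[ℝ] ℝ :=
  Real.sqrt (Matrix.det (Matrix.of fun i j =>
      g.inner x (orientedBasis o x i) (orientedBasis o x j))) • (orientedBasis o x).det

/-- The 4-form `B^m(f₁, f₂)_{(g₀, g₁)} = A₄^m(f₁, f₂)_{(g₀, g₁)} Vol_{M, g₀}`. -/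
def connesForm (o : ManifoldOrientation M) (m : ℕ) (f₁ f₂ : M → ℝ) (g₀ g₁ : RMetric M) :
    ∀ x : M, (TangentSpace (𝓡 4) x) [⋀^Fin 4]→ₗ[ℝ] ℝ :=
  fun x => connesCoeff m g₀ g₁ f₁ f₂ x • volumeForm o g₀ x

/-- The conformally rescaled metric `f g`, for a positive smooth function `f`. -/
def rescale (f : M → ℝ) (hf : ContMDiff (𝓡 4) 𝓘(ℝ) ∞ f) (hpos : ∀ x, 0 < f x)
    (g : RMetric M) : RMetric M where
  inner x := f x • g.inner x
  symm x v w := by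
    simp [g.symm x v w]
  pos x v hv := by
    simpa using mul_pos (hpos x) (g.pos x v hv)
  isVonNBounded x := by
    have h := (g.isVonNBounded x).image
      ((Real.sqrt (f x))⁻¹ • ContinuousLinearMap.id ℝ (TangentSpace (𝓡 4) x))
    refine h.subset ?_
    intro v hv
    have hs : Real.sqrt (f x) ≠ 0 := (Real.sqrt_pos.2 (hpos x)).ne'
    refine ⟨Real.sqrt (f x) • v, ?_, ?_⟩
    · have h2 := Real.mul_self_sqrt (hpos x).le
      have hv' : f x * g.inner x v v < 1 := by simpa using hv
      simpa [← mul_assoc, h2] using hv'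
    · simp [smul_smul, hs]
  contMDiff := hf.smul_section g.contMDiff

/-- `F` is a bimetric conformal invariant: it takes the same value at `(g₀, g₁)` and at
`(f g₀, f g₁)`, for all positive smooth functions `f`. -/
def IsBimetricConformalInvariant {α : Sort*} (F : RMetric M → RMetric M → α) : Prop :=
  ∀ (f : M → ℝ) (hf : ContMDiff (𝓡 4) 𝓘(ℝ) ∞ f) (hpos : ∀ x, 0 < f x) (g₀ g₁ : RMetric M),
    F (rescale f hf hpos g₀) (rescale f hf hpos g₁) = F g₀ g₁

end Manifold

end

end BimetricConformal

open BimetricConformal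

/-!
Everything is local: the density at `x` only depends on the germs, at the point `y₀` with the
coordinates of `x`, of the metric coefficients `G₀ + ε G₁` and of the functions `f₁`, `f₂` read in
the chart around `x`.

*Taylor expansion.* Call a function of `(ε, y)` a rational family if, near `(0, y₀)`, it is built
from `ε` and smooth functions of `y` by sums, products and inverses of nonvanishing functions
(`RationalFamily`). Rational families are stable under partial derivatives in `y`
(`RationalFamily.pderiv`), and under passing from a metric to its inverse, as the entries of the
inverse matrix are quotients of determinants. So the local expression is again a rational family
(`RationalFamily.localConnesDensity`), and at the fixed point `y₀` such a family is analytic in `ε`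
(`RationalFamily.analyticAt`).

*Conformal weight.* For `ĝ = e^{2σ} g` in dimension four, with `Δ` the nonnegative Laplacian and
`φ = ⟨du, dv⟩`,
* `r̂ = e^{-2σ} (r + 6 Δσ - 6 |dσ|²)`,
* `Δ̂ φ̂ = e^{-4σ} (Δφ - 2 φ Δσ + 2 ⟨dσ, dφ⟩)`,
* `⟨∇̂du, ∇̂dv⟩ = e^{-4σ} (⟨∇du, ∇dv⟩ - 2 ⟨dσ, dφ⟩ - ⟨dσ, du⟩ Δv - ⟨dσ, dv⟩ Δu + 2 |dσ|² φ
  + 2 ⟨dσ, du⟩ ⟨dσ, dv⟩)`, where the pairing on the left is that of `ĝ`,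
* `Δ̂u = e^{-2σ} (Δu - 2 ⟨dσ, du⟩)`,

and in the combination defining the density all terms containing `σ` cancel
(`IsLocalMetric.localConnesDensity_conformal`). All four formulas follow from the change of the
Christoffel symbols (`IsLocalMetric.christoffel_conformal`). The term `⟨dσ, dφ⟩` in the pairing of
Hessians comes from `dφ = ⟨∇du, dv⟩ + ⟨du, ∇dv⟩` (`IsLocalMetric.pderiv_gradInner`).

Since `f g₀ + ε f g₁ = f (g₀ + ε g₁)`, the densities of the rescaled and the original family are
related by the factor `f⁻²` for all small `ε`, of either sign, as soon as `g₀ + ε g₁` is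
nondegenerate near `x`; hence so are all Taylor coefficients (`connesCoeff_rescale`). The volume
form of `f g₀` is `f²` times that of `g₀` (`volumeForm_rescale`), and the two factors cancel.
-/

open Filter Topology

namespace BimetricConformal

/-! ### Partial derivatives -/

theorem pderiv_congr {i : Fin 4} {h k : E4 → ℝ} {y : E4} (e : h =ᶠ[𝓝 y] k) :
    pderiv i h y = pderiv i k y := by
  rw [pderiv, pderiv, e.fderiv_eq]

theorem pderiv_congr_of_isOpen {i : Fin 4} {h k : E4 → ℝ} {y : E4} {U : Set E4} (hU : IsOpen U)
    (hy : y ∈ U) (e : ∀ z ∈ U, h z = k z) : pderiv i h y = pderiv i k y :=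
  pderiv_congr (eventually_of_mem (hU.mem_nhds hy) e)

@[simp] theorem pderiv_const (i : Fin 4) (c : ℝ) (y : E4) : pderiv i (fun _ => c) y = 0 := by
  simp [pderiv]

theorem pderiv_add {i : Fin 4} {h k : E4 → ℝ} {y : E4} (hh : DifferentiableAt ℝ h y)
    (hk : DifferentiableAt ℝ k y) :
    pderiv i (fun z => h z + k z) y = pderiv i h y + pderiv i k y := by
  simp [pderiv, fderiv_fun_add hh hk]

theorem pderiv_sub {i : Fin 4} {h k : E4 → ℝ} {y : E4} (hh : DifferentiableAt ℝ h y)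
    (hk : DifferentiableAt ℝ k y) :
    pderiv i (fun z => h z - k z) y = pderiv i h y - pderiv i k y := by
  simp [pderiv, fderiv_fun_sub hh hk]

theorem pderiv_mul {i : Fin 4} {h k : E4 → ℝ} {y : E4} (hh : DifferentiableAt ℝ h y)
    (hk : DifferentiableAt ℝ k y) :
    pderiv i (fun z => h z * k z) y = pderiv i h y * k y + h y * pderiv i k y := by
  simp [pderiv, fderiv_fun_mul hh hk]; ring

theorem pderiv_const_mul {i : Fin 4} {h : E4 → ℝ} {y : E4} (c : ℝ)
    (hh : DifferentiableAt ℝ h y) :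
    pderiv i (fun z => c * h z) y = c * pderiv i h y := by
  simp [pderiv_mul (differentiableAt_const c) hh]

theorem pderiv_sum {ι : Type*} {i : Fin 4} {h : ι → E4 → ℝ} {y : E4} {s : Finset ι}
    (hh : ∀ a ∈ s, DifferentiableAt ℝ (h a) y) :
    pderiv i (fun z => ∑ a ∈ s, h a z) y = ∑ a ∈ s, pderiv i (h a) y := by
  simp [pderiv, fderiv_fun_sum hh]

theorem pderiv_inv {i : Fin 4} {h : E4 → ℝ} {y : E4} (hh : DifferentiableAt ℝ h y)
    (h0 : h y ≠ 0) :
    pderiv i (fun z => (h z)⁻¹) y = -(pderiv i h y * ((h y)⁻¹ * (h y)⁻¹)) := by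
  have := ((hasDerivAt_inv h0).comp_hasFDerivAt y hh.hasFDerivAt).fderiv
  simp only [Function.comp_def] at this
  rw [pderiv, this]
  simp [pderiv]
  field_simp

theorem pderiv_exp {i : Fin 4} {h : E4 → ℝ} {y : E4} (hh : DifferentiableAt ℝ h y) :
    pderiv i (fun z => Real.exp (h z)) y = Real.exp (h y) * pderiv i h y := by
  rw [pderiv, fderiv_exp hh]
  simp [pderiv]

theorem contDiffAt_pderiv {i : Fin 4} {h : E4 → ℝ} {y : E4} (hh : ContDiffAt ℝ ∞ h y) :
    ContDiffAt ℝ ∞ (pderiv i h) y :=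
  (hh.fderiv_right (m := ∞) (by simp)).clm_apply contDiffAt_const

theorem pderiv_comm {i j : Fin 4} {h : E4 → ℝ} {y : E4} (hh : ContDiffAt ℝ ∞ h y) :
    pderiv i (pderiv j h) y = pderiv j (pderiv i h) y := by
  have hd : DifferentiableAt ℝ (fderiv ℝ h) y :=
    (hh.fderiv_right (m := ∞) (by simp)).differentiableAt (by simp)
  have key : ∀ a b : Fin 4, pderiv a (pderiv b h) y
      = fderiv ℝ (fderiv ℝ h) y (EuclideanSpace.single a 1) (EuclideanSpace.single b 1) := by
    intro a b
    have : pderiv b h = fun z => fderiv ℝ h z (EuclideanSpace.single b 1) := rfl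
    rw [pderiv, this, fderiv_clm_apply hd (differentiableAt_const _)]
    simp
  rw [key, key]
  exact hh.isSymmSndFDerivAt (by simpa using ENat.LEInfty.out) _ _

/-! ### Rational families -/

/-- Entries of a matrix inverse, as a quotient of determinants. -/
theorem matrix_inv_apply (A : Matrix (Fin 4) (Fin 4) ℝ) (i j : Fin 4) :
    A⁻¹ i j = A.det⁻¹ * A.adjugate i j := by
  simp [Matrix.inv_def]

/-- Functions of `(ε, y)` near `(0, y₀)` which are built rationally from `ε` and from smooth
functions of `y`. Only the germ at `(0, y₀)` matters: this is the content of the constructor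
`congr`. -/
inductive RationalFamily (y₀ : E4) : (ℝ → E4 → ℝ) → Prop
  | smooth (a : E4 → ℝ) (ha : ContDiffAt ℝ ∞ a y₀) : RationalFamily y₀ fun _ => a
  | param : RationalFamily y₀ fun ε _ => ε
  | add {h k : ℝ → E4 → ℝ} : RationalFamily y₀ h → RationalFamily y₀ k →
      RationalFamily y₀ fun ε y => h ε y + k ε y
  | mul {h k : ℝ → E4 → ℝ} : RationalFamily y₀ h → RationalFamily y₀ k →
      RationalFamily y₀ fun ε y => h ε y * k ε y
  | inv {h : ℝ → E4 → ℝ} : RationalFamily y₀ h → h 0 y₀ ≠ 0 →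
      RationalFamily y₀ fun ε y => (h ε y)⁻¹
  | congr {h k : ℝ → E4 → ℝ} : RationalFamily y₀ h →
      (∀ᶠ p : ℝ × E4 in 𝓝 (0, y₀), h p.1 p.2 = k p.1 p.2) → RationalFamily y₀ k

namespace RationalFamily

variable {y₀ : E4} {h k : ℝ → E4 → ℝ}

theorem const (c : ℝ) : RationalFamily y₀ fun _ _ => c := smooth _ contDiffAt_const

theorem neg (hh : RationalFamily y₀ h) : RationalFamily y₀ fun ε y => -h ε y := by
  simpa using (const (-1)).mul hh

theorem sub (hh : RationalFamily y₀ h) (hk : RationalFamily y₀ k) :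
    RationalFamily y₀ fun ε y => h ε y - k ε y := by
  simpa [sub_eq_add_neg] using hh.add hk.neg

theorem sum {ι : Type*} {s : Finset ι} {h : ι → ℝ → E4 → ℝ}
    (hh : ∀ a, RationalFamily y₀ (h a)) : RationalFamily y₀ fun ε y => ∑ a ∈ s, h a ε y := by
  classical
  induction s using Finset.induction_on with
  | empty => simpa using const 0
  | insert a s ha ih => simpa [Finset.sum_insert ha] using (hh a).add ih

theorem prod {ι : Type*} {s : Finset ι} {h : ι → ℝ → E4 → ℝ}
    (hh : ∀ a, RationalFamily y₀ (h a)) : RationalFamily y₀ fun ε y => ∏ a ∈ s, h a ε y := by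
  classical
  induction s using Finset.induction_on with
  | empty => simpa using const 1
  | insert a s ha ih => simpa [Finset.prod_insert ha] using (hh a).mul ih

theorem contDiffAt (hh : RationalFamily y₀ h) :
    ContDiffAt ℝ ∞ (fun p : ℝ × E4 => h p.1 p.2) (0, y₀) := by
  induction hh with
  | smooth a ha => exact ContDiffAt.comp (0, y₀) (g := a) ha contDiffAt_snd
  | param => exact contDiffAt_fst
  | add _ _ h1 h2 => exact h1.add h2
  | mul _ _ h1 h2 => exact h1.mul h2
  | inv _ h0 h1 => exact h1.inv h0
  | congr _ e h1 => exact h1.congr_of_eventuallyEq (e.mono fun _ hp => hp.symm)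

theorem contDiffAt_zero (hh : RationalFamily y₀ h) : ContDiffAt ℝ ∞ (h 0) y₀ :=
  ContDiffAt.comp (g := fun p : ℝ × E4 => h p.1 p.2) (f := fun y => ((0 : ℝ), y)) y₀
    hh.contDiffAt (contDiffAt_const.prodMk contDiffAt_id)

theorem eventually_differentiableAt (hh : RationalFamily y₀ h) :
    ∀ᶠ p : ℝ × E4 in 𝓝 (0, y₀), DifferentiableAt ℝ (h p.1) p.2 := by
  have h1 : ContDiffAt ℝ 1 (fun p : ℝ × E4 => h p.1 p.2) (0, y₀) :=
    hh.contDiffAt.of_le (by simp)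
  filter_upwards [h1.eventually (by simp)] with p hp
  have h2 := hp.differentiableAt (by simp)
  exact DifferentiableAt.comp (g := fun p : ℝ × E4 => h p.1 p.2) (f := fun y => (p.1, y)) p.2 h2
    ((differentiableAt_const _).prodMk differentiableAt_id)

/-- Values of a rational family at the base point are analytic in the parameter. -/
theorem analyticAt (hh : RationalFamily y₀ h) : AnalyticAt ℝ (fun ε => h ε y₀) 0 := by
  induction hh with
  | smooth a ha => exact analyticAt_const
  | param => exact analyticAt_id
  | add _ _ h1 h2 => exact h1.add h2
  | mul _ _ h1 h2 => exact h1.mul h2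
  | inv _ h0 h1 => exact h1.inv h0
  | congr _ e h1 =>
    exact h1.congr ((Continuous.prodMk_left y₀).continuousAt.eventually e)

theorem eventually_pderiv_eq {i : Fin 4}
    (e : ∀ᶠ p : ℝ × E4 in 𝓝 (0, y₀), h p.1 p.2 = k p.1 p.2) :
    ∀ᶠ p : ℝ × E4 in 𝓝 (0, y₀), pderiv i (h p.1) p.2 = pderiv i (k p.1) p.2 := by
  filter_upwards [e.eventually_nhds] with p hp
  exact pderiv_congr ((Continuous.prodMk_right p.1).continuousAt.eventually hp)

/-- Rational families are closed under partial derivatives in `y`. -/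
theorem pderiv (i : Fin 4) (hh : RationalFamily y₀ h) :
    RationalFamily y₀ fun ε => BimetricConformal.pderiv i (h ε) := by
  induction hh with
  | smooth a ha => exact smooth _ (contDiffAt_pderiv ha)
  | param => exact (const 0).congr (by simp)
  | @add h k hh hk h1 h2 =>
    refine (h1.add h2).congr ?_
    filter_upwards [hh.eventually_differentiableAt, hk.eventually_differentiableAt] with p a b
    exact (pderiv_add a b).symm
  | @mul h k hh hk h1 h2 =>
    refine ((h1.mul hk).add (hh.mul h2)).congr ?_
    filter_upwards [hh.eventually_differentiableAt, hk.eventually_differentiableAt] with p a b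
    exact (pderiv_mul a b).symm
  | @inv h hh h0 h1 =>
    refine (h1.mul ((hh.inv h0).mul (hh.inv h0))).neg.congr ?_
    filter_upwards [hh.eventually_differentiableAt,
      hh.contDiffAt.continuousAt.eventually_ne h0] with p a b
    exact (pderiv_inv a b).symm
  | congr _ e h1 => exact h1.congr (eventually_pderiv_eq e)

theorem det {n : Type*} [Fintype n] [DecidableEq n] {G : ℝ → E4 → Matrix n n ℝ}
    (hG : ∀ i j, RationalFamily y₀ fun ε y => G ε y i j) :
    RationalFamily y₀ fun ε y => (G ε y).det := by
  simp only [Matrix.det_apply']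
  exact sum fun σ => (const _).mul (prod fun i => hG _ _)

section Geometry

variable {G : ℝ → E4 → Matrix (Fin 4) (Fin 4) ℝ} {u v : ℝ → E4 → ℝ}
  (hG : ∀ i j, RationalFamily y₀ fun ε y => G ε y i j) (h0 : (G 0 y₀).det ≠ 0)

include hG h0

theorem matrixInv (i j : Fin 4) : RationalFamily y₀ fun ε y => (G ε y)⁻¹ i j := by
  simp only [matrix_inv_apply, Matrix.adjugate_apply]
  refine ((det hG).inv h0).mul (det fun a b => ?_)
  by_cases ha : a = j
  · subst ha; simpa using const _
  · simpa [Matrix.updateRow_ne ha] using hG a b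

theorem christoffel (k i j : Fin 4) :
    RationalFamily y₀ fun ε => BimetricConformal.christoffel (G ε) k i j :=
  (const _).mul <| sum fun l => (matrixInv hG h0 k l).mul <|
    (((hG i l).pderiv j).add ((hG j l).pderiv i)).sub ((hG i j).pderiv l)

theorem scalarCurvature : RationalFamily y₀ fun ε => BimetricConformal.scalarCurvature (G ε) :=
  have Γ := christoffel hG h0
  sum fun j => sum fun l => (matrixInv hG h0 j l).mul <| sum fun k =>
    (((Γ k j l).pderiv k).sub ((Γ k k l).pderiv j)).add <| sum fun b =>
      ((Γ k k b).mul (Γ b j l)).sub ((Γ k j b).mul (Γ b k l))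

theorem gradInner (hu : RationalFamily y₀ u) (hv : RationalFamily y₀ v) :
    RationalFamily y₀ fun ε => BimetricConformal.gradInner (G ε) (u ε) (v ε) :=
  sum fun j => sum fun l => ((matrixInv hG h0 j l).mul (hu.pderiv j)).mul (hv.pderiv l)

theorem hessian (hu : RationalFamily y₀ u) (i j : Fin 4) :
    RationalFamily y₀ fun ε => BimetricConformal.hessian (G ε) (u ε) i j :=
  ((hu.pderiv j).pderiv i).sub <| sum fun k => (christoffel hG h0 k i j).mul (hu.pderiv k)

theorem laplacian (hu : RationalFamily y₀ u) :
    RationalFamily y₀ fun ε => BimetricConformal.laplacian (G ε) (u ε) :=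
  neg <| sum fun i => sum fun j => (matrixInv hG h0 i j).mul (hessian hG h0 hu i j)

theorem hessianInner (hu : RationalFamily y₀ u) (hv : RationalFamily y₀ v) :
    RationalFamily y₀ fun ε => BimetricConformal.hessianInner (G ε) (u ε) (v ε) :=
  sum fun i => sum fun j => sum fun p => sum fun q =>
    (((matrixInv hG h0 i p).mul (matrixInv hG h0 j q)).mul (hessian hG h0 hu i j)).mul
      (hessian hG h0 hv p q)

theorem localConnesDensity (hu : RationalFamily y₀ u) (hv : RationalFamily y₀ v) :
    RationalFamily y₀ fun ε => BimetricConformal.localConnesDensity (G ε) (u ε) (v ε) :=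
  (((((const _).mul (scalarCurvature hG h0)).mul (gradInner hG h0 hu hv)).add
    (laplacian hG h0 (gradInner hG h0 hu hv))).add (hessianInner hG h0 hu hv)).sub
    ((const _).mul ((laplacian hG h0 hu).mul (laplacian hG h0 hv)))

end Geometry

end RationalFamily

/-! ### Pointwise tensor algebra -/

section Algebra

/-- The full contraction `∑ A^{jl} S_{jl}`. -/
def contract (A S : Fin 4 → Fin 4 → ℝ) : ℝ := ∑ j, ∑ l, A j l * S j l

/-- The vector `A^{kl} t_l`. -/
def raise (A : Fin 4 → Fin 4 → ℝ) (t : Fin 4 → ℝ) (k : Fin 4) : ℝ := ∑ l, A k l * t l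

/-- The tensor `δ^k_i t_j + δ^k_j t_i - g_{ij} t^k`, by which the Christoffel symbols of
`e^{2σ} g` and of `g` differ if `t = dσ`; here `A` is the inverse of `g`. -/
def christoffelShift (A g : Fin 4 → Fin 4 → ℝ) (t : Fin 4 → ℝ) (k i j : Fin 4) : ℝ :=
  (if k = i then t j else 0) + (if k = j then t i else 0) - g i j * raise A t k

/-- `g` is symmetric with symmetric inverse `A`. -/
structure IsMetricPair (A g : Fin 4 → Fin 4 → ℝ) : Prop where
  symm_inv : ∀ i j, A i j = A j i
  symm : ∀ i j, g i j = g j i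
  inv_mul : ∀ i j, ∑ l, A i l * g l j = if i = j then 1 else 0
  mul_inv : ∀ i j, ∑ l, g i l * A l j = if i = j then 1 else 0

variable {A g : Fin 4 → Fin 4 → ℝ} {t : Fin 4 → ℝ}

theorem contract_congr {S R : Fin 4 → Fin 4 → ℝ} (h : ∀ i j, S i j = R i j) :
    contract A S = contract A R := by
  rw [show S = R from funext fun i => funext fun j => h i j]

theorem contract_add (S R : Fin 4 → Fin 4 → ℝ) :
    contract A (fun i j => S i j + R i j) = contract A S + contract A R := by
  simp only [contract, mul_add, Finset.sum_add_distrib]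

theorem contract_sub (S R : Fin 4 → Fin 4 → ℝ) :
    contract A (fun i j => S i j - R i j) = contract A S - contract A R := by
  simp only [contract, mul_sub, Finset.sum_sub_distrib]

theorem contract_const_mul (c : ℝ) (S : Fin 4 → Fin 4 → ℝ) :
    contract A (fun i j => c * S i j) = c * contract A S := by
  simp only [contract, Finset.mul_sum, mul_left_comm]

theorem contract_mul_const (c : ℝ) (S : Fin 4 → Fin 4 → ℝ) :
    contract A (fun i j => S i j * c) = contract A S * c := by
  simp only [contract, Finset.sum_mul, mul_assoc]

theorem contract_sum (S : Fin 4 → Fin 4 → Fin 4 → ℝ) :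
    contract A (fun i j => ∑ b, S b i j) = ∑ b, contract A (S b) := by
  simp only [contract, Finset.mul_sum]
  exact (Finset.sum_congr rfl fun j _ => Finset.sum_comm).trans Finset.sum_comm

theorem contract_mul (s t : Fin 4 → ℝ) :
    contract A (fun i j => s i * t j) = ∑ k, s k * raise A t k := by
  simp only [contract, raise, Finset.mul_sum, mul_left_comm]

namespace IsMetricPair

variable (h : IsMetricPair A g)
include h

theorem contract_swap (S : Fin 4 → Fin 4 → ℝ) :
    contract A (fun i j => S j i) = contract A S := by
  rw [contract, Finset.sum_comm]
  exact Finset.sum_congr rfl fun i _ => Finset.sum_congr rfl fun j _ => by rw [h.symm_inv]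

theorem contract_mul' (s t : Fin 4 → ℝ) :
    contract A (fun i j => s i * t j) = ∑ k, raise A s k * t k := by
  rw [← h.contract_swap]
  rw [contract_congr (R := fun i j => t i * s j) fun i j => mul_comm _ _, contract_mul]
  simp only [mul_comm]

theorem contract_self : contract A g = 4 := by
  have : ∀ j, ∑ l, A j l * g j l = 1 := fun j => by
    have := h.inv_mul j j
    simp only [if_true] at this
    rw [← this]
    exact Finset.sum_congr rfl fun l _ => by rw [h.symm]
  simp [contract, this]

theorem lower_raise (t : Fin 4 → ℝ) (i : Fin 4) : ∑ k, g k i * raise A t k = t i := by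
  simp only [raise, Finset.mul_sum, ← mul_assoc]
  rw [Finset.sum_comm]
  simp only [← Finset.sum_mul, h.symm _ i, h.mul_inv]
  simp

theorem christoffelShift_comm (k i j : Fin 4) :
    christoffelShift A g t k i j = christoffelShift A g t k j i := by
  rw [christoffelShift, christoffelShift, h.symm]; ring

theorem sum_christoffelShift (b : Fin 4) :
    ∑ k, christoffelShift A g t k k b = 4 * t b := by
  simp only [christoffelShift, Finset.sum_sub_distrib, Finset.sum_add_distrib, h.lower_raise]
  simp

theorem contract_christoffelShift (k : Fin 4) :
    contract A (christoffelShift A g t k) = -2 * raise A t k := by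
  have e : christoffelShift A g t k = fun i j =>
      ((if k = i then (1 : ℝ) else 0) * t j + (if k = j then (1 : ℝ) else 0) * t i)
        - g i j * raise A t k := by
    funext i j; simp [christoffelShift]
  rw [e, contract_sub, contract_add, contract_mul,
    h.contract_swap (fun j i => (if k = j then (1 : ℝ) else 0) * t i), contract_mul,
    contract_mul_const, h.contract_self]
  simp
  ring

/-- The partial trace of a product of the shift with a general tensor `X`. -/
theorem contract_christoffelShift_mul (X : Fin 4 → Fin 4 → Fin 4 → ℝ) :
    contract A (fun j l => ∑ k, ∑ b, christoffelShift A g t k j b * X b k l)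
      = (∑ b, t b * contract A (X b)) + (∑ l, raise A t l * ∑ k, X k k l)
        - ∑ k, raise A t k * ∑ l, X l k l := by
  have e : ∀ j l, ∑ k, ∑ b, christoffelShift A g t k j b * X b k l
      = (∑ b, t b * X b j l) + t j * (∑ k, X k k l)
        - ∑ b, ∑ k, raise A t k * (g j b * X b k l) := by
    intro j l
    simp only [christoffelShift, sub_mul, add_mul, Finset.sum_sub_distrib,
      Finset.sum_add_distrib, ite_mul, zero_mul, Finset.sum_ite_eq, Finset.mem_univ, if_true]
    congr 1
    · congr 1
      · rw [Finset.sum_comm]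
        simp
      · simp [Finset.mul_sum]
    · rw [Finset.sum_comm]
      simp only [mul_assoc, mul_left_comm]
  have e2 : ∀ k, ∑ b, contract A (fun j l => g j b * X b k l) = ∑ l, X l k l := by
    intro k
    refine Finset.sum_congr rfl fun b _ => ?_
    have := h.contract_mul' (fun j => g j b) (fun l => X b k l)
    rw [this]
    simp [raise, h.inv_mul]
  rw [contract_congr e, contract_sub, contract_add, contract_sum, h.contract_mul', contract_sum]
  simp only [contract_const_mul, contract_sum]
  congr 1
  rw [Finset.sum_comm]
  simp only [← Finset.mul_sum, e2]

/-- The change of the quadratic part of the scalar curvature when the Christoffel symbols `Γ` are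
replaced by `Γ + C`. -/
theorem contract_quadratic_shift
    {Γ : Fin 4 → Fin 4 → Fin 4 → ℝ} (hΓ : ∀ k i j, Γ k i j = Γ k j i)
    {C : Fin 4 → Fin 4 → Fin 4 → ℝ} (hC : C = christoffelShift A g t) :
    contract A (fun j l => ∑ k, ∑ b, ((Γ k k b + C k k b) * (Γ b j l + C b j l)
        - (Γ k j b + C k j b) * (Γ b k l + C b k l)))
      = contract A (fun j l => ∑ k, ∑ b, (Γ k k b * Γ b j l - Γ k j b * Γ b k l))
        + 2 * (∑ b, t b * contract A (Γ b))
        - 2 * (∑ b, raise A t b * ∑ k, Γ k k b) - 6 * (∑ k, raise A t k * t k) := by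
  have Csymm : ∀ k i j, C k i j = C k j i := fun k i j => by
    rw [hC, h.christoffelShift_comm]
  have s1 : ∀ b, ∑ k, C k k b = 4 * t b := fun b => by
    rw [hC]; exact h.sum_christoffelShift b
  have s2 : ∀ k, contract A (C k) = -2 * raise A t k := fun k => by
    rw [hC]; exact h.contract_christoffelShift k
  -- a trace over the first two indices times a trace with `A`
  have tr : ∀ X Y : Fin 4 → Fin 4 → Fin 4 → ℝ,
      contract A (fun j l => ∑ k, ∑ b, X k k b * Y b j l)
        = ∑ b, (∑ k, X k k b) * contract A (Y b) := by
    intro X Y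
    have : ∀ j l, ∑ k, ∑ b, X k k b * Y b j l = ∑ b, (∑ k, X k k b) * Y b j l := by
      intro j l
      rw [Finset.sum_comm]
      exact Finset.sum_congr rfl fun b _ => by rw [← Finset.sum_mul]
    rw [contract_congr this, contract_sum]
    simp only [contract_const_mul]
  have s3 : ∀ X : Fin 4 → Fin 4 → Fin 4 → ℝ, (∀ k i j, X k i j = X k j i) →
      contract A (fun j l => ∑ k, ∑ b, C k j b * X b k l) = ∑ b, t b * contract A (X b) := by
    intro X hX
    have : ∀ k, ∑ l, X l k l = ∑ l, X l l k := fun k => Finset.sum_congr rfl fun l _ => hX _ _ _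
    rw [hC, h.contract_christoffelShift_mul]
    simp only [this]
    ring
  have s4 : contract A (fun j l => ∑ k, ∑ b, Γ k j b * C b k l)
      = contract A (fun j l => ∑ k, ∑ b, C k j b * Γ b k l) := by
    rw [← h.contract_swap]
    refine contract_congr fun j l => ?_
    rw [Finset.sum_comm]
    refine Finset.sum_congr rfl fun b _ => Finset.sum_congr rfl fun k _ => ?_
    rw [hΓ k l b, Csymm b k j]; ring
  have split : ∀ j l, ∑ k, ∑ b, ((Γ k k b + C k k b) * (Γ b j l + C b j l)
        - (Γ k j b + C k j b) * (Γ b k l + C b k l))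
      = (∑ k, ∑ b, (Γ k k b * Γ b j l - Γ k j b * Γ b k l))
        + (∑ k, ∑ b, Γ k k b * C b j l) + (∑ k, ∑ b, C k k b * Γ b j l)
        + (∑ k, ∑ b, C k k b * C b j l) - (∑ k, ∑ b, Γ k j b * C b k l)
        - (∑ k, ∑ b, C k j b * Γ b k l) - (∑ k, ∑ b, C k j b * C b k l) := by
    intro j l
    simp only [← Finset.sum_add_distrib, ← Finset.sum_sub_distrib]
    refine Finset.sum_congr rfl fun k _ => Finset.sum_congr rfl fun b _ => ?_
    ring
  rw [contract_congr split]
  simp only [contract_sub, contract_add, tr, s4, s3 _ hΓ, s3 _ Csymm, s1, s2]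
  have p1 : ∑ b, (∑ k, Γ k k b) * (-2 * raise A t b)
      = -2 * ∑ b, raise A t b * ∑ k, Γ k k b := by
    rw [Finset.mul_sum]; exact Finset.sum_congr rfl fun b _ => by ring
  have p2 : ∑ b, 4 * t b * contract A (Γ b) = 4 * ∑ b, t b * contract A (Γ b) := by
    rw [Finset.mul_sum]; exact Finset.sum_congr rfl fun b _ => by ring
  have p3 : ∑ b, 4 * t b * (-2 * raise A t b) = -8 * ∑ b, raise A t b * t b := by
    rw [Finset.mul_sum]; exact Finset.sum_congr rfl fun b _ => by ring
  have p4 : ∑ b, t b * (-2 * raise A t b) = -2 * ∑ b, raise A t b * t b := by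
    rw [Finset.mul_sum]; exact Finset.sum_congr rfl fun b _ => by ring
  rw [p1, p2, p3, p4]
  ring

theorem raise_metric (a k : Fin 4) : raise A (g a) k = if k = a then 1 else 0 := by
  rw [← h.inv_mul]
  exact Finset.sum_congr rfl fun l _ => by rw [h.symm]

/-- The trace of a metric-compatible derivative of `g`. -/
theorem contract_deriv_metric (X : Fin 4 → Fin 4 → ℝ) :
    contract A (fun i j => ∑ a, (X a i * g a j + X a j * g i a)) = 2 * ∑ a, X a a := by
  have : ∀ i j, ∑ a, (X a i * g a j + X a j * g i a)
      = (∑ a, X a i * g a j) + ∑ a, X a j * g a i := by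
    intro i j
    rw [← Finset.sum_add_distrib]
    exact Finset.sum_congr rfl fun a _ => by rw [h.symm i a]
  rw [contract_congr this, contract_add, h.contract_swap fun j i => ∑ a, X a j * g a i,
    contract_sum]
  simp only [contract_mul, h.raise_metric]
  simp
  ring

/-- The contribution of `∑ g^{jl} ∂_k C^k_{jl}` to the change of the scalar curvature. The
derivative `∂_k C^k_{jl}` is spelled out by the Leibniz rule, with `D = ∂dσ` and with `dg`, `dA`, `dT` the
derivatives of the metric, of its inverse and of the gradient of `σ`. -/
theorem contract_deriv_shift {Γ dg dA : Fin 4 → Fin 4 → Fin 4 → ℝ}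
    {D dT : Fin 4 → Fin 4 → ℝ}
    (hΓ : ∀ k i j, Γ k i j = Γ k j i)
    (hdg : ∀ m i j, dg m i j = ∑ a, (Γ a m i * g a j + Γ a m j * g i a))
    (hdA : ∀ m k l, dA m k l = -∑ a, (Γ k m a * A a l + Γ l m a * A k a))
    (hdT : ∀ m k, dT m k = ∑ l, (dA m k l * t l + A k l * D m l)) :
    contract A (fun j l => ∑ k, ((if k = j then D k l else 0) + (if k = l then D k j else 0)
        - (dg k j l * raise A t k + g j l * dT k k)))
      = -2 * contract A D + 2 * (∑ k, raise A t k * ∑ a, Γ a a k)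
        + 4 * ∑ b, t b * contract A (Γ b) := by
  have hT : ∑ k, dT k k = contract A D - (∑ k, raise A t k * ∑ a, Γ a a k)
      - ∑ b, t b * contract A (Γ b) := by
    have e1 : ∑ k, ∑ l, (∑ a, Γ k k a * A a l) * t l = ∑ k, raise A t k * ∑ a, Γ a a k := by
      have : ∀ k, ∑ l, (∑ a, Γ k k a * A a l) * t l = ∑ a, Γ k k a * raise A t a := by
        intro k
        simp only [raise, Finset.sum_mul, Finset.mul_sum, mul_assoc]
        exact Finset.sum_comm
      simp only [this]
      rw [Finset.sum_comm]
      exact Finset.sum_congr rfl fun k _ => by rw [← Finset.sum_mul, mul_comm]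
    have e2 : ∑ k, ∑ l, (∑ a, Γ l k a * A k a) * t l = ∑ b, t b * contract A (Γ b) := by
      rw [Finset.sum_comm]
      refine Finset.sum_congr rfl fun l _ => ?_
      rw [← Finset.sum_mul, mul_comm, contract]
      simp only [mul_comm (A _ _)]
    rw [← e1, ← e2, contract]
    simp only [hdT, hdA, ← Finset.sum_sub_distrib]
    refine Finset.sum_congr rfl fun k _ => Finset.sum_congr rfl fun l _ => ?_
    rw [Finset.sum_add_distrib]
    ring
  have hc : ∀ m, contract A (dg m) = 2 * ∑ a, Γ a a m := fun m => by
    rw [contract_congr (hdg m), h.contract_deriv_metric fun a i => Γ a m i]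
    exact congrArg _ (Finset.sum_congr rfl fun a _ => hΓ _ _ _)
  have e : ∀ j l, ∑ k, ((if k = j then D k l else 0) + (if k = l then D k j else 0)
        - (dg k j l * raise A t k + g j l * dT k k))
      = D j l + D l j - ((∑ k, dg k j l * raise A t k) + g j l * ∑ k, dT k k) := by
    intro j l
    simp [Finset.sum_sub_distrib, Finset.sum_add_distrib, Finset.mul_sum]
  rw [contract_congr e, contract_sub, contract_add, contract_add, contract_sum,
    h.contract_swap D, contract_mul_const, h.contract_self, hT]
  simp only [contract_mul_const, hc]
  have : ∑ k, (2 * ∑ a, Γ a a k) * raise A t k = 2 * ∑ k, raise A t k * ∑ a, Γ a a k := by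
    rw [Finset.mul_sum]; exact Finset.sum_congr rfl fun k _ => by ring
  rw [this]
  ring

end IsMetricPair

/-- The pairing `∑ A^{ip} A^{jq} S_{ij} R_{pq}` of covariant 2-tensors. -/
def contract₂ (A S R : Fin 4 → Fin 4 → ℝ) : ℝ :=
  contract A fun i p => contract A fun j q => S i j * R p q

theorem contract₂_add_left (S S' R : Fin 4 → Fin 4 → ℝ) :
    contract₂ A (fun i j => S i j + S' i j) R = contract₂ A S R + contract₂ A S' R := by
  simp only [contract₂, add_mul, contract_add]

theorem contract₂_const_mul_left (c : ℝ) (S R : Fin 4 → Fin 4 → ℝ) :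
    contract₂ A (fun i j => c * S i j) R = c * contract₂ A S R := by
  simp only [contract₂, mul_assoc, contract_const_mul]

theorem contract₂_mul_right (S : Fin 4 → Fin 4 → ℝ) (a b : Fin 4 → ℝ) :
    contract₂ A S (fun i j => a i * b j) = ∑ i, (∑ j, S i j * raise A b j) * raise A a i := by
  have : ∀ i p, contract A (fun j q => S i j * (a p * b q))
      = (∑ j, S i j * raise A b j) * a p := by
    intro i p
    have : ∀ j q, S i j * (a p * b q) = S i j * b q * a p := fun j q => by ring
    rw [contract_congr this, contract_mul_const, contract_mul]
  rw [contract₂, contract_congr this, contract_mul]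

theorem contract₂_mul_mul (a b a' b' : Fin 4 → ℝ) :
    contract₂ A (fun i j => a i * b j) (fun i j => a' i * b' j)
      = contract A (fun i j => a i * a' j) * contract A (fun i j => b i * b' j) := by
  rw [contract₂_mul_right, contract_mul, contract_mul, Finset.sum_mul]
  refine Finset.sum_congr rfl fun i _ => ?_
  rw [Finset.mul_sum, Finset.sum_mul]
  exact Finset.sum_congr rfl fun j _ => by ring

namespace IsMetricPair

variable (h : IsMetricPair A g)
include h

theorem contract₂_comm (S R : Fin 4 → Fin 4 → ℝ) : contract₂ A S R = contract₂ A R S := by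
  rw [contract₂, ← h.contract_swap]
  refine contract_congr fun i p => ?_
  rw [← h.contract_swap]
  exact contract_congr fun j q => mul_comm _ _

theorem contract₂_metric (S : Fin 4 → Fin 4 → ℝ) : contract₂ A S g = contract A S := by
  simp only [contract₂, contract_mul, h.raise_metric]
  simp

/-- The change of `⟨∇du, ∇dv⟩`, where `H = ∇du`, `K = ∇dv`, and the arguments `u`, `v` stand for the
differentials. -/
theorem contract₂_hessian_shift {H K : Fin 4 → Fin 4 → ℝ} (hH : ∀ i j, H i j = H j i)
    (hK : ∀ i j, K i j = K j i) (u v : Fin 4 → ℝ) :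
    contract₂ A
        (fun i j => H i j - t i * u j - t j * u i + g i j * contract A fun p q => t p * u q)
        (fun i j => K i j - t i * v j - t j * v i + g i j * contract A fun p q => t p * v q)
      = contract₂ A H K - 2 * contract₂ A H (fun i j => t i * v j)
        - 2 * contract₂ A K (fun i j => t i * u j)
        + (contract A fun p q => t p * v q) * contract A H
        + (contract A fun p q => t p * u q) * contract A K
        + 2 * (contract A fun p q => t p * t q) * (contract A fun p q => u p * v q)
        + 2 * (contract A fun p q => t p * u q) * (contract A fun p q => t p * v q) := by
  have comm : ∀ a b : Fin 4 → ℝ, (contract A fun p q => a p * b q)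
      = contract A fun p q => b p * a q := fun a b => by
    rw [← h.contract_swap]; exact contract_congr fun _ _ => mul_comm _ _
  have flip : ∀ S : Fin 4 → Fin 4 → ℝ, (∀ i j, S i j = S j i) → ∀ a b : Fin 4 → ℝ,
      contract₂ A S (fun i j => a i * b j) = contract₂ A S (fun i j => b i * a j) := by
    intro S hS a b
    rw [contract₂_mul_right, contract₂_mul_right]
    simp only [Finset.sum_mul]
    rw [Finset.sum_comm]
    exact Finset.sum_congr rfl fun i _ => Finset.sum_congr rfl fun j _ => by rw [hS j i]; ring
  have hl : ∀ (S : Fin 4 → Fin 4 → ℝ) (w : Fin 4 → ℝ) (R : Fin 4 → Fin 4 → ℝ) (c : ℝ),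
      contract₂ A (fun i j => S i j - t i * w j - t j * w i + g i j * c) R
        = contract₂ A S R - contract₂ A R (fun i j => t i * w j)
          - contract₂ A R (fun i j => w i * t j) + c * contract A R := by
    intro S w R c
    have : (fun i j => S i j - t i * w j - t j * w i + g i j * c)
        = fun i j => ((S i j + (-1) * (t i * w j)) + (-1) * (w i * t j)) + c * g i j := by
      funext i j; ring
    rw [this, contract₂_add_left, contract₂_add_left, contract₂_add_left,
      contract₂_const_mul_left, contract₂_const_mul_left, contract₂_const_mul_left,
      h.contract₂_comm _ R, h.contract₂_comm _ R, h.contract₂_comm _ R, h.contract₂_comm _ R,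
      h.contract₂_metric]
    ring
  have hcl : ∀ (S : Fin 4 → Fin 4 → ℝ) (w : Fin 4 → ℝ) (c : ℝ),
      contract A (fun i j => S i j - t i * w j - t j * w i + g i j * c)
        = contract A S - 2 * (contract A fun i j => t i * w j) + 4 * c := by
    intro S w c
    rw [contract_add, contract_sub, contract_sub, contract_mul_const, h.contract_self,
      h.contract_swap fun i j => t i * w j]
    ring
  rw [hl, h.contract₂_comm H, hl, hl, hl, hcl, h.contract₂_comm K H]
  simp only [contract₂_mul_mul, flip H hH v, flip K hK u, comm u t]
  ring

end IsMetricPair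

end Algebra

/-! ### Metrics on open subsets of `ℝ⁴` -/

/-- `G` is a smooth nondegenerate metric on the open set `U`. Its signature is arbitrary, so that
the structure applies to `g₀ + ε g₁` also where this is not known to be definite. -/
structure IsLocalMetric (G : E4 → Matrix (Fin 4) (Fin 4) ℝ) (U : Set E4) : Prop where
  isOpen : IsOpen U
  contDiffAt : ∀ y ∈ U, ∀ i j, ContDiffAt ℝ ∞ (fun z => G z i j) y
  isSymm : ∀ y ∈ U, (G y).IsSymm
  det_ne_zero : ∀ y ∈ U, (G y).det ≠ 0

/-- The components `g^{ij}` of the inverse metric. -/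
noncomputable def inverseMetric (G : E4 → Matrix (Fin 4) (Fin 4) ℝ) (y : E4)
    (i j : Fin 4) : ℝ :=
  (G y)⁻¹ i j

/-- The components `∂_i u` of the differential of `u`. -/
noncomputable def differential (u : E4 → ℝ) (y : E4) (i : Fin 4) : ℝ := pderiv i u y

theorem gradInner_eq_contract (G : E4 → Matrix (Fin 4) (Fin 4) ℝ) (u v : E4 → ℝ) (y : E4) :
    gradInner G u v y
      = contract (inverseMetric G y) fun j l => differential u y j * differential v y l := by
  simp only [gradInner, contract, mul_assoc]; rfl

theorem laplacian_eq_contract (G : E4 → Matrix (Fin 4) (Fin 4) ℝ) (u : E4 → ℝ) (y : E4) :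
    laplacian G u y = -contract (inverseMetric G y) fun i j => hessian G u i j y := rfl

theorem hessianInner_eq_contract₂ (G : E4 → Matrix (Fin 4) (Fin 4) ℝ) (u v : E4 → ℝ) (y : E4) :
    hessianInner G u v y = contract₂ (inverseMetric G y) (fun i j => hessian G u i j y)
      (fun i j => hessian G v i j y) := by
  simp only [hessianInner, contract₂, contract, Finset.mul_sum]
  refine Finset.sum_congr rfl fun i _ => ?_
  rw [Finset.sum_comm]
  refine Finset.sum_congr rfl fun p _ => Finset.sum_congr rfl fun j _ =>
    Finset.sum_congr rfl fun q _ => ?_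
  simp only [inverseMetric]; ring

theorem scalarCurvature_eq_contract (G : E4 → Matrix (Fin 4) (Fin 4) ℝ) (y : E4) :
    scalarCurvature G y = contract (inverseMetric G y) fun j l =>
      (∑ k, pderiv k (christoffel G k j l) y) - (∑ k, pderiv j (christoffel G k k l) y)
        + ∑ k, ∑ b, (christoffel G k k b y * christoffel G b j l y
          - christoffel G k j b y * christoffel G b k l y) := by
  simp only [← Finset.sum_sub_distrib (f := fun k => pderiv k (christoffel G k _ _) y),
    ← Finset.sum_add_distrib (f := fun k => pderiv k (christoffel G k _ _) y - _)]
  rfl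

namespace IsLocalMetric

variable {G : E4 → Matrix (Fin 4) (Fin 4) ℝ} {U : Set E4} {y : E4}

theorem isMetricPair (hG : IsLocalMetric G U) (hy : y ∈ U) :
    IsMetricPair (inverseMetric G y) (G y) where
  symm_inv i j := by
    have := (hG.isSymm y hy)
    have h2 : (G y)⁻¹.IsSymm := by
      rw [Matrix.IsSymm, Matrix.transpose_nonsing_inv, this.eq]
    exact h2.apply j i
  symm i j := (hG.isSymm y hy).apply j i
  inv_mul i j := by
    have := congrFun₂ (Matrix.nonsing_inv_mul (G y) (hG.det_ne_zero y hy).isUnit) i j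
    rwa [Matrix.mul_apply, Matrix.one_apply] at this
  mul_inv i j := by
    have := congrFun₂ (Matrix.mul_nonsing_inv (G y) (hG.det_ne_zero y hy).isUnit) i j
    rwa [Matrix.mul_apply, Matrix.one_apply] at this

variable (hG : IsLocalMetric G U) (hy : y ∈ U)
include hG hy

theorem differentiableAt (i j : Fin 4) : DifferentiableAt ℝ (fun z => G z i j) y :=
  (hG.contDiffAt y hy i j).differentiableAt (by simp)

theorem rationalFamily (i j : Fin 4) : RationalFamily y fun _ z => G z i j :=
  .smooth _ (hG.contDiffAt y hy i j)

theorem contDiffAt_inverseMetric (i j : Fin 4) :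
    ContDiffAt ℝ ∞ (fun z => inverseMetric G z i j) y :=
  (RationalFamily.matrixInv (G := fun _ => G) (hG.rationalFamily hy)
    (hG.det_ne_zero y hy) i j).contDiffAt_zero

theorem contDiffAt_christoffel (k i j : Fin 4) : ContDiffAt ℝ ∞ (christoffel G k i j) y :=
  (RationalFamily.christoffel (G := fun _ => G) (hG.rationalFamily hy)
    (hG.det_ne_zero y hy) k i j).contDiffAt_zero

theorem contDiffAt_gradInner {u v : E4 → ℝ} (hu : ContDiffAt ℝ ∞ u y)
    (hv : ContDiffAt ℝ ∞ v y) : ContDiffAt ℝ ∞ (gradInner G u v) y :=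
  (RationalFamily.gradInner (G := fun _ => G) (hG.rationalFamily hy)
    (hG.det_ne_zero y hy) (.smooth u hu) (.smooth v hv)).contDiffAt_zero

theorem pderiv_symm (m i j : Fin 4) :
    pderiv m (fun z => G z i j) y = pderiv m (fun z => G z j i) y :=
  pderiv_congr_of_isOpen hG.isOpen hy fun z hz => (hG.isSymm z hz).apply j i

theorem christoffel_symm (k i j : Fin 4) : christoffel G k i j y = christoffel G k j i y := by
  rw [christoffel, christoffel]
  refine congrArg _ (Finset.sum_congr rfl fun l _ => ?_)
  rw [hG.pderiv_symm hy l i j]; ring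

theorem hessian_symm {u : E4 → ℝ} (hu : ContDiffAt ℝ ∞ u y) (i j : Fin 4) :
    hessian G u i j y = hessian G u j i y := by
  rw [hessian, hessian, pderiv_comm hu]
  simp only [hG.christoffel_symm hy _ i j]

theorem lower_christoffel (i j m : Fin 4) :
    ∑ a, christoffel G a i j y * G y a m
      = (1 / 2) * (pderiv j (fun z => G z i m) y + pderiv i (fun z => G z j m) y
        - pderiv m (fun z => G z i j) y) := by
  rw [← (hG.isMetricPair hy).lower_raise (fun l => (pderiv j (fun z => G z i l) y
    + pderiv i (fun z => G z j l) y - pderiv l (fun z => G z i j) y)), Finset.mul_sum]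
  refine Finset.sum_congr rfl fun a _ => ?_
  simp only [christoffel, raise, inverseMetric]
  ring

/-- Metric compatibility of the Levi-Civita connection. -/
theorem pderiv_metric (m i j : Fin 4) :
    pderiv m (fun z => G z i j) y
      = ∑ a, (christoffel G a m i y * G y a j + christoffel G a m j y * G y i a) := by
  have h := hG.isMetricPair hy
  rw [Finset.sum_add_distrib, hG.lower_christoffel hy]
  simp only [fun a => h.symm i a]
  rw [hG.lower_christoffel hy, hG.pderiv_symm hy m j i, hG.pderiv_symm hy j m i,
    hG.pderiv_symm hy i m j]
  ring

theorem pderiv_inverseMetric (m k l : Fin 4) :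
    pderiv m (fun z => inverseMetric G z k l) y
      = -∑ a, (christoffel G k m a y * inverseMetric G y a l
          + christoffel G l m a y * inverseMetric G y k a) := by
  let dA : Matrix (Fin 4) (Fin 4) ℝ := .of fun k l => pderiv m (fun z => inverseMetric G z k l) y
  let dG : Matrix (Fin 4) (Fin 4) ℝ := .of fun i j => pderiv m (fun z => G z i j) y
  let Γ : Matrix (Fin 4) (Fin 4) ℝ := .of fun a i => christoffel G a m i y
  have e1 : dA * G y + (G y)⁻¹ * dG = 0 := by
    ext k j
    have h1 : pderiv m (fun z => ∑ l, inverseMetric G z k l * G z l j) y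
        = pderiv m (fun _ => if k = j then 1 else 0) y :=
      pderiv_congr_of_isOpen hG.isOpen hy fun z hz => (hG.isMetricPair hz).inv_mul k j
    have hd : ∀ l, DifferentiableAt ℝ (fun z => inverseMetric G z k l) y := fun l =>
      (hG.contDiffAt_inverseMetric hy k l).differentiableAt (by simp)
    rw [pderiv_const, pderiv_sum fun l _ => (hd l).fun_mul (hG.differentiableAt hy l j)] at h1
    simp only [pderiv_mul (hd _) (hG.differentiableAt hy _ j), Finset.sum_add_distrib] at h1
    rw [Matrix.add_apply, Matrix.mul_apply, Matrix.mul_apply]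
    exact h1
  have e2 : dG = Γ.transpose * G y + G y * Γ := by
    ext i j
    simp only [dG, Matrix.of_apply, hG.pderiv_metric hy, Matrix.add_apply, Matrix.mul_apply,
      Γ, Matrix.transpose_apply, Finset.sum_add_distrib, mul_comm (G y i _)]
  have u := (hG.det_ne_zero y hy).isUnit
  have e3 : dA = -((G y)⁻¹ * Γ.transpose + Γ * (G y)⁻¹) := by
    have : dA = dA * G y * (G y)⁻¹ := by rw [Matrix.mul_assoc, Matrix.mul_nonsing_inv _ u, mul_one]
    rw [this, eq_neg_of_add_eq_zero_left e1, e2, mul_add, ← Matrix.mul_assoc (G y)⁻¹ (G y),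
      Matrix.nonsing_inv_mul _ u, one_mul, neg_mul, add_mul, ← Matrix.mul_assoc,
      Matrix.mul_assoc _ (G y), Matrix.mul_nonsing_inv _ u, mul_one]
  have := congrFun₂ e3 k l
  simp only [dA, Γ, Matrix.of_apply, Matrix.neg_apply, Matrix.add_apply, Matrix.mul_apply,
    Matrix.transpose_apply] at this
  rw [this, Finset.sum_add_distrib, add_comm]
  simp only [inverseMetric, mul_comm]

/-- `d⟨du, dv⟩ = ⟨∇du, dv⟩ + ⟨du, ∇dv⟩`. -/
theorem pderiv_gradInner {u v : E4 → ℝ} (hu : ContDiffAt ℝ ∞ u y) (hv : ContDiffAt ℝ ∞ v y)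
    (i : Fin 4) :
    pderiv i (gradInner G u v) y
      = (∑ j, hessian G u i j y * raise (inverseMetric G y) (differential v y) j)
        + ∑ j, hessian G v i j y * raise (inverseMetric G y) (differential u y) j := by
  have hd : ∀ j l, DifferentiableAt ℝ (fun z => inverseMetric G z j l) y := fun j l =>
    (hG.contDiffAt_inverseMetric hy j l).differentiableAt (by simp)
  have hu' : ∀ j, DifferentiableAt ℝ (pderiv j u) y := fun j =>
    (contDiffAt_pderiv hu).differentiableAt (by simp)
  have hv' : ∀ j, DifferentiableAt ℝ (pderiv j v) y := fun j =>
    (contDiffAt_pderiv hv).differentiableAt (by simp)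
  have e : pderiv i (gradInner G u v) y = ∑ j, ∑ l,
      ((pderiv i (fun z => inverseMetric G z j l) y * pderiv j u y
        + inverseMetric G y j l * pderiv i (pderiv j u) y) * pderiv l v y
        + inverseMetric G y j l * pderiv j u y * pderiv i (pderiv l v) y) := by
    have : gradInner G u v = fun z => ∑ j, ∑ l,
      inverseMetric G z j l * pderiv j u z * pderiv l v z := rfl
    rw [this, pderiv_sum fun j _ => DifferentiableAt.fun_sum fun l _ =>
      ((hd j l).fun_mul (hu' j)).fun_mul (hv' l)]
    refine Finset.sum_congr rfl fun j _ => ?_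
    rw [pderiv_sum fun l _ => ((hd j l).fun_mul (hu' j)).fun_mul (hv' l)]
    refine Finset.sum_congr rfl fun l _ => ?_
    rw [pderiv_mul ((hd j l).fun_mul (hu' j)) (hv' l), pderiv_mul (hd j l) (hu' j)]
  have h := hG.isMetricPair hy
  rw [e]
  simp only [hG.pderiv_inverseMetric hy]
  -- the derivative of the inverse metric supplies the Christoffel terms of both Hessians
  have t1 : ∀ p q : Fin 4 → ℝ,
      ∑ j, ∑ l, (∑ a, christoffel G j i a y * inverseMetric G y a l) * p j * q l
      = ∑ a, (∑ j, christoffel G j i a y * p j) * raise (inverseMetric G y) q a := by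
    intro p q
    have : ∀ j, ∑ l, (∑ a, christoffel G j i a y * inverseMetric G y a l) * p j * q l
        = ∑ a, christoffel G j i a y * p j * raise (inverseMetric G y) q a := by
      intro j
      simp only [raise, Finset.sum_mul, Finset.mul_sum]
      rw [Finset.sum_comm]
      exact Finset.sum_congr rfl fun a _ => Finset.sum_congr rfl fun l _ => by ring
    simp only [this]
    rw [Finset.sum_comm]
    simp only [Finset.sum_mul]
  have t2 : ∑ j, ∑ l, (∑ a, christoffel G l i a y * inverseMetric G y j a) * pderiv j u y
        * pderiv l v y
      = ∑ a, (∑ j, christoffel G j i a y * pderiv j v y)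
          * raise (inverseMetric G y) (differential u y) a := by
    have := t1 (differential v y) (differential u y)
    simp only [differential] at this
    rw [Finset.sum_comm]
    refine Eq.trans ?_ this
    refine Finset.sum_congr rfl fun l _ => Finset.sum_congr rfl fun j _ => ?_
    simp only [h.symm_inv j]
    ring
  have t3 : ∑ j, ∑ l, inverseMetric G y j l * pderiv j u y * pderiv i (pderiv l v) y
      = ∑ l, pderiv i (pderiv l v) y * raise (inverseMetric G y) (differential u y) l := by
    rw [Finset.sum_comm]
    refine Finset.sum_congr rfl fun l _ => ?_
    rw [raise, Finset.mul_sum]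
    exact Finset.sum_congr rfl fun j _ => by rw [h.symm_inv, differential]; ring
  have t4 : ∑ j, ∑ l, inverseMetric G y j l * pderiv i (pderiv j u) y * pderiv l v y
      = ∑ j, pderiv i (pderiv j u) y * raise (inverseMetric G y) (differential v y) j := by
    refine Finset.sum_congr rfl fun j _ => ?_
    rw [raise, Finset.mul_sum]
    exact Finset.sum_congr rfl fun l _ => by rw [differential]; ring
  have split : ∀ j l, (-(∑ a, (christoffel G j i a y * inverseMetric G y a l
        + christoffel G l i a y * inverseMetric G y j a)) * pderiv j u y
        + inverseMetric G y j l * pderiv i (pderiv j u) y) * pderiv l v y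
        + inverseMetric G y j l * pderiv j u y * pderiv i (pderiv l v) y
      = inverseMetric G y j l * pderiv i (pderiv j u) y * pderiv l v y
        - (∑ a, christoffel G j i a y * inverseMetric G y a l) * pderiv j u y * pderiv l v y
        + (inverseMetric G y j l * pderiv j u y * pderiv i (pderiv l v) y
        - (∑ a, christoffel G l i a y * inverseMetric G y j a) * pderiv j u y * pderiv l v y) := by
    intro j l
    rw [Finset.sum_add_distrib]; ring
  have t1' := t1 (differential u y) (differential v y)
  simp only [split]
  simp only [Finset.sum_add_distrib, Finset.sum_sub_distrib, t2, t3, t4, hessian, sub_mul]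
  rw [show ∑ j, ∑ l, (∑ a, christoffel G j i a y * inverseMetric G y a l) * pderiv j u y
    * pderiv l v y = _ from t1']
  rfl

end IsLocalMetric

section Conformal

/-! ### Conformal change of a local metric -/

/-- The conformally equivalent metric `e^{2σ} G`. -/
noncomputable def conformalMetric (σ : E4 → ℝ) (G : E4 → Matrix (Fin 4) (Fin 4) ℝ) (z : E4) :
    Matrix (Fin 4) (Fin 4) ℝ :=
  Real.exp (2 * σ z) • G z

variable {G : E4 → Matrix (Fin 4) (Fin 4) ℝ} {U : Set E4} {y : E4} {σ u v : E4 → ℝ}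

theorem pderiv_exp_const_mul {i : Fin 4} (c : ℝ) (hσ : DifferentiableAt ℝ σ y) :
    pderiv i (fun z => Real.exp (c * σ z)) y = Real.exp (c * σ y) * (c * pderiv i σ y) := by
  rw [pderiv_exp (hσ.const_mul c), pderiv_const_mul c hσ]

namespace IsLocalMetric

theorem conformal (hG : IsLocalMetric G U) (hσ : ∀ z ∈ U, ContDiffAt ℝ ∞ σ z) :
    IsLocalMetric (conformalMetric σ G) U where
  isOpen := hG.isOpen
  contDiffAt y hy i j :=
    (Real.contDiff_exp.contDiffAt.comp y (contDiffAt_const.mul (hσ y hy))).mul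
      (hG.contDiffAt y hy i j)
  isSymm y hy := (hG.isSymm y hy).smul _
  det_ne_zero y hy := by
    rw [conformalMetric, Matrix.det_smul]
    exact mul_ne_zero (pow_ne_zero _ (Real.exp_ne_zero _)) (hG.det_ne_zero y hy)

variable (hG : IsLocalMetric G U)
include hG

theorem inverseMetric_conformal (hy : y ∈ U) (i j : Fin 4) :
    inverseMetric (conformalMetric σ G) y i j
      = (Real.exp (2 * σ y))⁻¹ * inverseMetric G y i j := by
  have : (conformalMetric σ G y)⁻¹ = (Real.exp (2 * σ y))⁻¹ • (G y)⁻¹ := by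
    rw [conformalMetric]
    refine Matrix.inv_eq_left_inv ?_
    rw [Matrix.smul_mul, Matrix.mul_smul, smul_smul, inv_mul_cancel₀ (Real.exp_ne_zero _),
      one_smul, Matrix.nonsing_inv_mul _ (hG.det_ne_zero y hy).isUnit]
  simp [inverseMetric, this]

theorem contract_conformal (hy : y ∈ U) (S : Fin 4 → Fin 4 → ℝ) :
    contract (inverseMetric (conformalMetric σ G) y) S
      = (Real.exp (2 * σ y))⁻¹ * contract (inverseMetric G y) S := by
  simp only [contract, hG.inverseMetric_conformal hy, Finset.mul_sum, mul_assoc]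

theorem gradInner_conformal (hy : y ∈ U) (u v : E4 → ℝ) :
    gradInner (conformalMetric σ G) u v y = (Real.exp (2 * σ y))⁻¹ * gradInner G u v y := by
  rw [gradInner_eq_contract, hG.contract_conformal hy, ← gradInner_eq_contract]

theorem christoffel_conformal (hy : y ∈ U) (hσ : DifferentiableAt ℝ σ y) (k i j : Fin 4) :
    christoffel (conformalMetric σ G) k i j y
      = christoffel G k i j y
        + christoffelShift (inverseMetric G y) (G y) (differential σ y) k i j := by
  have h := hG.isMetricPair hy
  have hd : ∀ m a b, pderiv m (fun z => conformalMetric σ G z a b) y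
      = Real.exp (2 * σ y) * (2 * pderiv m σ y * G y a b + pderiv m (fun z => G z a b) y) := by
    intro m a b
    have : (fun z => conformalMetric σ G z a b) = fun z => Real.exp (2 * σ z) * G z a b := rfl
    rw [this, pderiv_mul (hσ.const_mul 2).exp (hG.differentiableAt hy a b),
      pderiv_exp_const_mul 2 hσ]
    ring
  have hs : ∀ a, ∑ l, inverseMetric G y k l * G y a l = if k = a then 1 else 0 := fun a =>
    h.raise_metric a k
  have e : ∀ l, (conformalMetric σ G y)⁻¹ k l
        * (pderiv j (fun z => conformalMetric σ G z i l) y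
          + pderiv i (fun z => conformalMetric σ G z j l) y
          - pderiv l (fun z => conformalMetric σ G z i j) y)
      = inverseMetric G y k l * (pderiv j (fun z => G z i l) y + pderiv i (fun z => G z j l) y
          - pderiv l (fun z => G z i j) y)
        + 2 * pderiv j σ y * (inverseMetric G y k l * G y i l)
        + 2 * pderiv i σ y * (inverseMetric G y k l * G y j l)
        - 2 * G y i j * (inverseMetric G y k l * differential σ y l) := by
    intro l
    have hi := hG.inverseMetric_conformal (σ := σ) hy k l
    rw [inverseMetric] at hi
    rw [hi, hd, hd, hd, differential]
    field_simp
    ring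
  rw [christoffel, Finset.sum_congr rfl fun l _ => e l, Finset.sum_sub_distrib,
    Finset.sum_add_distrib, Finset.sum_add_distrib, ← Finset.mul_sum, ← Finset.mul_sum,
    ← Finset.mul_sum, hs, hs]
  change _ = _ + ((if k = i then pderiv j σ y else 0) + (if k = j then pderiv i σ y else 0)
    - G y i j * ∑ l, inverseMetric G y k l * differential σ y l)
  rw [christoffel]
  simp only [inverseMetric, mul_ite, mul_one, mul_zero]
  split_ifs <;> ring

theorem hessian_conformal (hy : y ∈ U) (hσ : DifferentiableAt ℝ σ y) (u : E4 → ℝ)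
    (i j : Fin 4) :
    hessian (conformalMetric σ G) u i j y
      = hessian G u i j y - differential σ y i * differential u y j
        - differential σ y j * differential u y i
        + G y i j * contract (inverseMetric G y)
            fun p q => differential σ y p * differential u y q := by
  have h := hG.isMetricPair hy
  simp only [hessian, hG.christoffel_conformal hy hσ, add_mul, Finset.sum_add_distrib]
  rw [h.contract_mul']
  simp only [christoffelShift, sub_mul, add_mul, Finset.sum_add_distrib, Finset.sum_sub_distrib,
    ite_mul, zero_mul, Finset.sum_ite_eq', Finset.mem_univ, if_true, mul_assoc, ← Finset.mul_sum]
  simp only [differential]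
  ring

theorem laplacian_conformal (hy : y ∈ U) (hσ : DifferentiableAt ℝ σ y) (u : E4 → ℝ) :
    laplacian (conformalMetric σ G) u y
      = (Real.exp (2 * σ y))⁻¹ * (laplacian G u y - 2 * gradInner G σ u y) := by
  have h := hG.isMetricPair hy
  have hg : ∀ c, contract (inverseMetric G y) (fun i j => G y i j * c) = 4 * c := fun c => by
    rw [← h.contract_self]; exact contract_mul_const c (G y)
  rw [laplacian_eq_contract, hG.contract_conformal hy,
    contract_congr (hG.hessian_conformal hy hσ u), contract_add, contract_sub, contract_sub, hg,
    laplacian_eq_contract, gradInner_eq_contract,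
    h.contract_swap fun i j => differential σ y i * differential u y j]
  ring

theorem contract₂_conformal (hy : y ∈ U) (S R : Fin 4 → Fin 4 → ℝ) :
    contract₂ (inverseMetric (conformalMetric σ G) y) S R
      = ((Real.exp (2 * σ y))⁻¹) ^ 2 * contract₂ (inverseMetric G y) S R := by
  simp only [contract₂, hG.contract_conformal hy, contract_const_mul]
  ring

/-- `⟨dσ, d⟨du, dv⟩⟩ = ⟨∇du, dσ ⊗ dv⟩ + ⟨∇dv, dσ ⊗ du⟩`. -/
theorem gradInner_gradInner (hy : y ∈ U) (hu : ContDiffAt ℝ ∞ u y) (hv : ContDiffAt ℝ ∞ v y)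
    (σ : E4 → ℝ) :
    gradInner G σ (gradInner G u v) y
      = contract₂ (inverseMetric G y) (fun i j => hessian G u i j y)
          (fun i j => differential σ y i * differential v y j)
        + contract₂ (inverseMetric G y) (fun i j => hessian G v i j y)
          (fun i j => differential σ y i * differential u y j) := by
  rw [gradInner_eq_contract, (hG.isMetricPair hy).contract_mul', contract₂_mul_right,
    contract₂_mul_right, ← Finset.sum_add_distrib]
  refine Finset.sum_congr rfl fun i _ => ?_
  rw [differential, hG.pderiv_gradInner hy hu hv]
  ring

theorem hessianInner_conformal (hy : y ∈ U) (hσ : DifferentiableAt ℝ σ y)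
    (hu : ContDiffAt ℝ ∞ u y) (hv : ContDiffAt ℝ ∞ v y) :
    hessianInner (conformalMetric σ G) u v y
      = ((Real.exp (2 * σ y))⁻¹) ^ 2 * (hessianInner G u v y
        - 2 * gradInner G σ (gradInner G u v) y
        - gradInner G σ v y * laplacian G u y - gradInner G σ u y * laplacian G v y
        + 2 * gradInner G σ σ y * gradInner G u v y
        + 2 * gradInner G σ u y * gradInner G σ v y) := by
  rw [hessianInner_eq_contract₂, hG.contract₂_conformal hy, hG.gradInner_gradInner hy hu hv]
  simp only [hG.hessian_conformal hy hσ]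
  rw [(hG.isMetricPair hy).contract₂_hessian_shift (hG.hessian_symm hy hu)
    (hG.hessian_symm hy hv)]
  simp only [laplacian_eq_contract, gradInner_eq_contract, hessianInner_eq_contract₂]
  ring

/-- The Hessian of `e^{-2σ} φ`. -/
theorem hessian_exp_mul {φ : E4 → ℝ} (hσ : ∀ z ∈ U, ContDiffAt ℝ ∞ σ z)
    (hφ : ∀ z ∈ U, ContDiffAt ℝ ∞ φ z) (hy : y ∈ U) (i j : Fin 4) :
    hessian G (fun z => (Real.exp (2 * σ z))⁻¹ * φ z) i j y
      = (Real.exp (2 * σ y))⁻¹ * (hessian G φ i j y - 2 * φ y * hessian G σ i j y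
        - 2 * (differential σ y j * differential φ y i)
        - 2 * (differential σ y i * differential φ y j)
        + 4 * φ y * (differential σ y i * differential σ y j)) := by
  simp only [← Real.exp_neg, ← neg_mul]
  have dd : ∀ {w : E4 → ℝ}, (∀ z ∈ U, ContDiffAt ℝ ∞ w z) → ∀ z ∈ U, DifferentiableAt ℝ w z :=
    fun hw z hz => (hw z hz).differentiableAt (by simp)
  have hσ1 := dd hσ
  have hφ1 := dd hφ
  have hσ2 : ∀ a, ∀ z ∈ U, DifferentiableAt ℝ (pderiv a σ) z :=
    fun a => dd fun z hz => contDiffAt_pderiv (hσ z hz)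
  have hφ2 : ∀ a, ∀ z ∈ U, DifferentiableAt ℝ (pderiv a φ) z :=
    fun a => dd fun z hz => contDiffAt_pderiv (hφ z hz)
  have hE : ∀ z ∈ U, DifferentiableAt ℝ (fun z => Real.exp (-2 * σ z)) z :=
    fun z hz => ((hσ1 z hz).const_mul (-2)).exp
  have h1 : ∀ a, ∀ z ∈ U, pderiv a (fun z => Real.exp (-2 * σ z) * φ z) z
      = Real.exp (-2 * σ z) * (pderiv a φ z - 2 * (pderiv a σ z * φ z)) := by
    intro a z hz
    rw [pderiv_mul (hE z hz) (hφ1 z hz), pderiv_exp_const_mul _ (hσ1 z hz)]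
    ring
  have h2 : pderiv i (pderiv j fun z => Real.exp (-2 * σ z) * φ z) y
      = Real.exp (-2 * σ y) * (-2 * pderiv i σ y) * (pderiv j φ y - 2 * (pderiv j σ y * φ y))
        + Real.exp (-2 * σ y) * (pderiv i (pderiv j φ) y
          - 2 * (pderiv i (pderiv j σ) y * φ y + pderiv j σ y * pderiv i φ y)) := by
    have hp := (hσ2 j y hy).fun_mul (hφ1 y hy)
    rw [pderiv_congr_of_isOpen hG.isOpen hy (h1 j),
      pderiv_mul (hE y hy) ((hφ2 j y hy).fun_sub (hp.const_mul 2)),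
      pderiv_exp_const_mul _ (hσ1 y hy), pderiv_sub (hφ2 j y hy) (hp.const_mul 2),
      pderiv_const_mul 2 hp, pderiv_mul (hσ2 j y hy) (hφ1 y hy)]
  have h3 : ∑ k, christoffel G k i j y * (Real.exp (-2 * σ y)
        * (pderiv k φ y - 2 * (pderiv k σ y * φ y)))
      = Real.exp (-2 * σ y) * ((∑ k, christoffel G k i j y * pderiv k φ y)
        - 2 * φ y * ∑ k, christoffel G k i j y * pderiv k σ y) := by
    rw [Finset.mul_sum (a := 2 * φ y), ← Finset.sum_sub_distrib, Finset.mul_sum]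
    exact Finset.sum_congr rfl fun k _ => by ring
  simp only [hessian, h2, h1 _ y hy, h3, differential]
  ring

theorem laplacian_exp_mul {φ : E4 → ℝ} (hσ : ∀ z ∈ U, ContDiffAt ℝ ∞ σ z)
    (hφ : ∀ z ∈ U, ContDiffAt ℝ ∞ φ z) (hy : y ∈ U) :
    laplacian G (fun z => (Real.exp (2 * σ z))⁻¹ * φ z) y
      = (Real.exp (2 * σ y))⁻¹ * (laplacian G φ y - 2 * φ y * laplacian G σ y
        + 4 * gradInner G σ φ y - 4 * φ y * gradInner G σ σ y) := by
  rw [laplacian_eq_contract, contract_congr (hG.hessian_exp_mul hσ hφ hy), contract_const_mul,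
    contract_add, contract_sub, contract_sub, contract_sub, contract_const_mul,
    contract_const_mul, contract_const_mul, contract_const_mul,
    (hG.isMetricPair hy).contract_swap fun i j => differential σ y i * differential φ y j]
  simp only [laplacian_eq_contract, gradInner_eq_contract]
  ring

omit hG in
theorem gradInner_exp_mul {φ : E4 → ℝ} (hσ : DifferentiableAt ℝ σ y)
    (hφ : DifferentiableAt ℝ φ y) :
    gradInner G σ (fun z => (Real.exp (2 * σ z))⁻¹ * φ z) y
      = (Real.exp (2 * σ y))⁻¹ * (gradInner G σ φ y - 2 * φ y * gradInner G σ σ y) := by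
  simp only [← Real.exp_neg, ← neg_mul]
  have h1 : ∀ a, differential (fun z => Real.exp (-2 * σ z) * φ z) y a
      = Real.exp (-2 * σ y) * differential φ y a
        + Real.exp (-2 * σ y) * (-2 * φ y) * differential σ y a := by
    intro a
    rw [differential, pderiv_mul (hσ.const_mul (-2)).exp hφ, pderiv_exp_const_mul _ hσ]
    simp only [differential]
    ring
  simp only [gradInner_eq_contract, h1, mul_add, contract_add, mul_left_comm (differential σ y _),
    contract_const_mul]
  ring

/-- Both the Laplacian and the pairing `⟨du, dv⟩` are those of the metric `e^{2σ} G`. -/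
theorem laplacian_gradInner_conformal (hσ : ∀ z ∈ U, ContDiffAt ℝ ∞ σ z)
    (hu : ∀ z ∈ U, ContDiffAt ℝ ∞ u z) (hv : ∀ z ∈ U, ContDiffAt ℝ ∞ v z) (hy : y ∈ U) :
    laplacian (conformalMetric σ G) (gradInner (conformalMetric σ G) u v) y
      = ((Real.exp (2 * σ y))⁻¹) ^ 2 * (laplacian G (gradInner G u v) y
        - 2 * gradInner G u v y * laplacian G σ y
        + 2 * gradInner G σ (gradInner G u v) y) := by
  have hφ : ∀ z ∈ U, ContDiffAt ℝ ∞ (gradInner G u v) z := fun z hz =>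
    hG.contDiffAt_gradInner hz (hu z hz) (hv z hz)
  have e : gradInner (conformalMetric σ G) u v
      =ᶠ[𝓝 y] fun z => (Real.exp (2 * σ z))⁻¹ * gradInner G u v z :=
    eventually_of_mem (hG.isOpen.mem_nhds hy) fun z hz => hG.gradInner_conformal hz u v
  have hσ' := (hσ y hy).differentiableAt (by simp)
  have hl : laplacian (conformalMetric σ G) (gradInner (conformalMetric σ G) u v) y
      = laplacian (conformalMetric σ G)
        (fun z => (Real.exp (2 * σ z))⁻¹ * gradInner G u v z) y := by
    have e1 : ∀ j, pderiv j (gradInner (conformalMetric σ G) u v)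
      =ᶠ[𝓝 y] pderiv j fun z => (Real.exp (2 * σ z))⁻¹ * gradInner G u v z := fun j =>
      e.eventually_nhds.mono fun z hz => pderiv_congr hz
    simp only [laplacian, hessian, fun i j => pderiv_congr (i := i) (e1 j), pderiv_congr e]
  rw [hl, hG.laplacian_conformal hy hσ', hG.laplacian_exp_mul hσ hφ hy,
    gradInner_exp_mul hσ' ((hφ y hy).differentiableAt (by simp))]
  ring

/-- Since `Δ` is the nonnegative Laplacian, this is the formula
`e^{-2σ} (r - 2 (n - 1) tr ∇dσ - (n - 2) (n - 1) |dσ|²)` in dimension `n = 4`. -/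
theorem scalarCurvature_conformal (hσ : ∀ z ∈ U, ContDiffAt ℝ ∞ σ z) (hy : y ∈ U) :
    scalarCurvature (conformalMetric σ G) y
      = (Real.exp (2 * σ y))⁻¹ * (scalarCurvature G y + 6 * laplacian G σ y
        - 6 * gradInner G σ σ y) := by
  have h := hG.isMetricPair hy
  have hσ1 : ∀ z ∈ U, DifferentiableAt ℝ σ z := fun z hz => (hσ z hz).differentiableAt (by simp)
  let C : Fin 4 → Fin 4 → Fin 4 → E4 → ℝ := fun k i j z =>
    christoffelShift (inverseMetric G z) (G z) (differential σ z) k i j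
  have hΓd : ∀ k i j, DifferentiableAt ℝ (christoffel G k i j) y := fun k i j =>
    (hG.contDiffAt_christoffel hy k i j).differentiableAt (by simp)
  have hAd : ∀ k l, DifferentiableAt ℝ (fun z => inverseMetric G z k l) y := fun k l =>
    (hG.contDiffAt_inverseMetric hy k l).differentiableAt (by simp)
  have htd : ∀ k, DifferentiableAt ℝ (fun z => differential σ z k) y := fun k =>
    (contDiffAt_pderiv (hσ y hy)).differentiableAt (by simp)
  have hTd : ∀ k, DifferentiableAt ℝ
      (fun z => raise (inverseMetric G z) (differential σ z) k) y := fun k =>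
    DifferentiableAt.fun_sum fun l _ => (hAd k l).fun_mul (htd l)
  have hdd : ∀ k i j : Fin 4,
      DifferentiableAt ℝ (fun z => if k = i then differential σ z j else 0) y := by
    intro k i j
    by_cases hki : k = i
    · simpa [hki] using htd j
    · simp [hki]
  have hdp : ∀ m k i j : Fin 4, pderiv m (fun z => if k = i then differential σ z j else 0) y
      = if k = i then pderiv m (pderiv j σ) y else 0 := by
    intro m k i j
    by_cases hki : k = i
    · simp only [hki, if_true]; rfl
    · simp [hki]
  have hCd : ∀ k i j, DifferentiableAt ℝ (C k i j) y := fun k i j =>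
    ((hdd k i j).fun_add (hdd k j i)).fun_sub ((hG.differentiableAt hy i j).fun_mul (hTd k))
  have hC : ∀ m k i j, pderiv m (C k i j) y
      = (if k = i then pderiv m (pderiv j σ) y else 0)
        + (if k = j then pderiv m (pderiv i σ) y else 0)
        - (pderiv m (fun z => G z i j) y * raise (inverseMetric G y) (differential σ y) k
          + G y i j * pderiv m (fun z => raise (inverseMetric G z) (differential σ z) k) y) := by
    intro m k i j
    have e : C k i j = fun z => (if k = i then differential σ z j else 0)
      + (if k = j then differential σ z i else 0)
      - G z i j * raise (inverseMetric G z) (differential σ z) k := rfl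
    rw [e, pderiv_sub ((hdd k i j).fun_add (hdd k j i))
      ((hG.differentiableAt hy i j).fun_mul (hTd k)), pderiv_add (hdd k i j) (hdd k j i),
      pderiv_mul (hG.differentiableAt hy i j) (hTd k), hdp, hdp]
  have hT : ∀ m k, pderiv m (fun z => raise (inverseMetric G z) (differential σ z) k) y
      = ∑ l, (pderiv m (fun z => inverseMetric G z k l) y * differential σ y l
        + inverseMetric G y k l * pderiv m (pderiv l σ) y) := by
    intro m k
    simp only [raise]
    rw [pderiv_sum fun l _ => (hAd k l).fun_mul (htd l)]
    refine Finset.sum_congr rfl fun l _ => ?_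
    rw [pderiv_mul (hAd k l) (htd l)]
    rfl
  -- the trace of the shift is `4 dσ`, which is differentiated as a whole
  have htr : ∀ j l, ∑ k, pderiv j (C k k l) y = 4 * pderiv j (pderiv l σ) y := by
    intro j l
    rw [← pderiv_sum fun k _ => hCd k k l, pderiv_congr_of_isOpen (k := fun z =>
      4 * differential σ z l) hG.isOpen hy fun z hz => (hG.isMetricPair hz).sum_christoffelShift l,
      pderiv_const_mul 4 (htd l)]
    rfl
  have hΓ' : ∀ k i j, ∀ z ∈ U, christoffel (conformalMetric σ G) k i j z
      = christoffel G k i j z + C k i j z := fun k i j z hz =>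
    hG.christoffel_conformal hz (hσ1 z hz) k i j
  have hΓ'' : ∀ m k i j, pderiv m (christoffel (conformalMetric σ G) k i j) y
      = pderiv m (christoffel G k i j) y + pderiv m (C k i j) y := fun m k i j => by
    rw [pderiv_congr_of_isOpen hG.isOpen hy (hΓ' k i j), pderiv_add (hΓd k i j) (hCd k i j)]
  have q := h.contract_quadratic_shift (hG.christoffel_symm hy)
    (C := fun k i j => C k i j y) (t := differential σ y) rfl
  have d := h.contract_deriv_shift (t := differential σ y)
    (D := fun m j => pderiv m (pderiv j σ) y)
    (dT := fun m k => pderiv m (fun z => raise (inverseMetric G z) (differential σ z) k) y)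
    (hG.christoffel_symm hy) (hG.pderiv_metric hy) (hG.pderiv_inverseMetric hy) hT
  have hl : laplacian G σ y = -(contract (inverseMetric G y) fun i j => pderiv i (pderiv j σ) y)
      + ∑ b, differential σ y b * contract (inverseMetric G y)
        fun i j => christoffel G b i j y := by
    simp only [laplacian_eq_contract, hessian, contract_sub, contract_sum, contract_mul_const]
    simp only [differential, mul_comm]
    ring
  rw [scalarCurvature_eq_contract, hG.contract_conformal hy, scalarCurvature_eq_contract, hl,
    gradInner_eq_contract, h.contract_mul']
  simp only [hΓ'', hΓ' _ _ _ y hy, Finset.sum_add_distrib (f := fun k => pderiv _ _ y), htr]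
  simp only [contract_add, contract_sub, contract_const_mul] at q ⊢
  simp only [← hC] at d
  rw [q, d]
  ring

/-- The local expression has conformal weight `-2` in the conformal factor `e^{2σ}`: the terms in
`σ` contributed by its four summands cancel. -/
theorem localConnesDensity_conformal (hσ : ∀ z ∈ U, ContDiffAt ℝ ∞ σ z)
    (hu : ∀ z ∈ U, ContDiffAt ℝ ∞ u z) (hv : ∀ z ∈ U, ContDiffAt ℝ ∞ v z) (hy : y ∈ U) :
    localConnesDensity (conformalMetric σ G) u v y
      = ((Real.exp (2 * σ y))⁻¹) ^ 2 * localConnesDensity G u v y := by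
  have hσ' := (hσ y hy).differentiableAt (by simp)
  rw [localConnesDensity, hG.scalarCurvature_conformal hσ hy, hG.gradInner_conformal hy,
    hG.laplacian_gradInner_conformal hσ hu hv hy,
    hG.hessianInner_conformal hy hσ' (hu y hy) (hv y hy),
    hG.laplacian_conformal hy hσ', hG.laplacian_conformal hy hσ', localConnesDensity]
  ring

end IsLocalMetric

end Conformal

/-! ### Metrics on manifolds in charts -/

section Manifold

variable {M : Type*} [TopologicalSpace M] [ChartedSpace E4 M] [IsManifold (𝓡 4) ∞ M]

theorem isInvertible_mfderiv_extChartAt_symm {x : M} {y : E4}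
    (hy : y ∈ (extChartAt (𝓡 4) x).target) :
    (mfderiv 𝓘(ℝ, E4) (𝓡 4) (extChartAt (𝓡 4) x).symm y).IsInvertible := by
  have : IsManifold (𝓡 4) 1 M := IsManifold.of_le (n := ∞) (by simp)
  have h := isInvertible_mfderivWithin_extChartAt_symm (I := 𝓡 4) hy
  rwa [ModelWithCorners.range_eq_univ, mfderivWithin_univ] at h

/-- The coordinate vector fields are smooth. They are the tangent map of the inverse chart along
the constant vector fields of `ℝ⁴`. -/
theorem contMDiffAt_coordVector {x : M} {y : E4} (hy : y ∈ (extChartAt (𝓡 4) x).target)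
    (i : Fin 4) :
    ContMDiffAt 𝓘(ℝ, E4) (𝓡 4).tangent ∞
      (fun z => (⟨(extChartAt (𝓡 4) x).symm z, coordVector x i z⟩ : TangentBundle (𝓡 4) M)) y := by
  have : IsManifold (𝓡 4) 1 M := IsManifold.of_le (n := ∞) (by simp)
  have ho := isOpen_extChartAt_target (I := 𝓡 4) x
  have h1 := (contMDiffOn_extChartAt_symm (I := 𝓡 4) (n := ∞) x).contMDiffOn_tangentMapWithin
    (m := ∞) (by simp) ho.uniqueMDiffOn
  have h2 : ContMDiffAt 𝓘(ℝ, E4) 𝓘(ℝ, E4).tangent ∞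
      (fun z : E4 => (⟨z, EuclideanSpace.single i 1⟩ : TangentBundle 𝓘(ℝ, E4) E4)) y :=
    contMDiffAt_vectorSpace_iff_contDiffAt.2 contDiffAt_const
  have h3 := (h1 ⟨y, EuclideanSpace.single i 1⟩ hy).comp_of_eq (x := y)
    (s := (extChartAt (𝓡 4) x).target) h2.contMDiffWithinAt (fun z hz => hz) rfl
  refine (h3.contMDiffAt (ho.mem_nhds hy)).congr_of_eventuallyEq ?_
  filter_upwards [ho.mem_nhds hy] with z hz
  simp only [Function.comp, tangentMapWithin, mfderivWithin_of_isOpen ho hz, coordVector]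

theorem contDiffAt_metricCoeff (g : RMetric M) {x : M} {y : E4}
    (hy : y ∈ (extChartAt (𝓡 4) x).target) (i j : Fin 4) :
    ContDiffAt ℝ ∞ (fun z => metricCoeff g.inner x z i j) y := by
  have : IsManifold (𝓡 4) 1 M := IsManifold.of_le (n := ∞) (by simp)
  have hs : ContMDiffAt 𝓘(ℝ, E4) (𝓡 4) ∞ (extChartAt (𝓡 4) x).symm y :=
    (contMDiffOn_extChartAt_symm (I := 𝓡 4) (n := ∞) x).contMDiffAt
      ((isOpen_extChartAt_target (I := 𝓡 4) x).mem_nhds hy)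
  have hg := (g.contMDiff ((extChartAt (𝓡 4) x).symm y)).comp y hs
  have h := ContMDiffAt.clm_bundle_apply₂ (F₃ := ℝ) (E₃ := fun _ : M => ℝ) hg
    (contMDiffAt_coordVector hy i) (contMDiffAt_coordVector hy j)
  have h2 := (Bundle.contMDiffAt_totalSpace.1 h).2
  exact contMDiffAt_iff_contDiffAt.1 h2

/-- The components of a Riemannian metric form a positive definite matrix, since the coordinate
vectors are the images of the standard basis under an invertible differential. -/
theorem posDef_metricCoeff (g : RMetric M) {x : M} {y : E4}
    (hy : y ∈ (extChartAt (𝓡 4) x).target) : (metricCoeff g.inner x y).PosDef := by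
  let L : E4 →L[ℝ] TangentSpace (𝓡 4) ((extChartAt (𝓡 4) x).symm y) :=
    mfderiv 𝓘(ℝ, E4) (𝓡 4) (extChartAt (𝓡 4) x).symm y
  have hL : Function.Injective L := (isInvertible_mfderiv_extChartAt_symm hy).injective
  refine Matrix.PosDef.of_dotProduct_mulVec_pos ?_ fun c hc => ?_
  · ext i j
    exact g.symm _ _ _
  · let w : E4 := ∑ i, c i • EuclideanSpace.single i 1
    have hw : w ≠ 0 := by
      intro h
      apply hc
      funext k
      have := congrArg (fun z : E4 => z k) h
      simpa [w, Pi.single_apply] using this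
    have hq : star c ⬝ᵥ (metricCoeff g.inner x y).mulVec c = g.inner _ (L w) (L w) := by
      have hLw : L w = ∑ i, c i • coordVector x i y := by
        simp only [w, map_sum, map_smul]; rfl
      rw [hLw]
      simp only [map_sum, map_smul, sum_apply, smul_apply,
        smul_eq_mul, dotProduct, Matrix.mulVec, Finset.mul_sum]
      refine Finset.sum_congr rfl fun i _ => Finset.sum_congr rfl fun j _ => ?_
      rw [g.symm]
      change c i * (metricCoeff g.inner x y i j * c j) = c i * (c j * metricCoeff g.inner x y i j)
      ring
    rw [hq]
    exact g.pos _ _ fun h => hw (hL (h.trans (map_zero L).symm))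

theorem isLocalMetric_metricCoeff (g : RMetric M) (x : M) :
    IsLocalMetric (metricCoeff g.inner x) (extChartAt (𝓡 4) x).target where
  isOpen := isOpen_extChartAt_target x
  contDiffAt _ hy := contDiffAt_metricCoeff g hy
  isSymm _ _ := Matrix.IsSymm.ext fun _ _ => g.symm _ _ _
  det_ne_zero _ hy := (posDef_metricCoeff g hy).det_pos.ne'

theorem contDiffAt_comp_extChartAt_symm {f : M → ℝ} (hf : ContMDiff (𝓡 4) 𝓘(ℝ) ∞ f) {x : M}
    {y : E4} (hy : y ∈ (extChartAt (𝓡 4) x).target) :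
    ContDiffAt ℝ ∞ (fun z => f ((extChartAt (𝓡 4) x).symm z)) y :=
  contMDiffAt_iff_contDiffAt.1 <| (hf _).comp y <|
    (contMDiffOn_extChartAt_symm (I := 𝓡 4) (n := ∞) x).contMDiffAt
      ((isOpen_extChartAt_target (I := 𝓡 4) x).mem_nhds hy)

theorem metricCoeff_perturb (g₀ g₁ : RMetric M) (ε : ℝ) (x : M) (y : E4) :
    metricCoeff (perturb g₀ g₁ ε) x y
      = metricCoeff g₀.inner x y + ε • metricCoeff g₁.inner x y := by
  rfl

/-- The density of `g₀ + ε g₁` in the chart around `x` is a rational family, because `g₀` is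
nondegenerate. -/
theorem rationalFamily_connesDensity (g₀ g₁ : RMetric M) {f₁ f₂ : M → ℝ}
    (hf₁ : ContMDiff (𝓡 4) 𝓘(ℝ) ∞ f₁) (hf₂ : ContMDiff (𝓡 4) 𝓘(ℝ) ∞ f₂) (x : M) :
    RationalFamily (extChartAt (𝓡 4) x x) fun ε => localConnesDensity
      (metricCoeff (perturb g₀ g₁ ε) x) (fun y => f₁ ((extChartAt (𝓡 4) x).symm y))
      (fun y => f₂ ((extChartAt (𝓡 4) x).symm y)) := by
  have hx := mem_extChartAt_target (I := 𝓡 4) x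
  refine .localConnesDensity (fun i j => ?_) ?_
    (.smooth _ (contDiffAt_comp_extChartAt_symm hf₁ hx))
    (.smooth _ (contDiffAt_comp_extChartAt_symm hf₂ hx))
  · simp only [metricCoeff_perturb, Matrix.add_apply, Matrix.smul_apply, smul_eq_mul]
    exact (RationalFamily.smooth _ (contDiffAt_metricCoeff g₀ hx i j)).add
      (.mul .param (.smooth _ (contDiffAt_metricCoeff g₁ hx i j)))
  · simpa [metricCoeff_perturb] using (posDef_metricCoeff g₀ hx).det_pos.ne'

theorem analyticAt_connesDensity (g₀ g₁ : RMetric M) {f₁ f₂ : M → ℝ}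
    (hf₁ : ContMDiff (𝓡 4) 𝓘(ℝ) ∞ f₁) (hf₂ : ContMDiff (𝓡 4) 𝓘(ℝ) ∞ f₂) (x : M) :
    AnalyticAt ℝ (fun ε => connesDensity (perturb g₀ g₁ ε) f₁ f₂ x) 0 :=
  (rationalFamily_connesDensity g₀ g₁ hf₁ hf₂ x).analyticAt

/-- For small `ε`, of either sign, the density of `f (g₀ + ε g₁)` is `f⁻²` times that of
`g₀ + ε g₁`. -/
theorem eventually_connesDensity_rescale (g₀ g₁ : RMetric M) {f f₁ f₂ : M → ℝ}
    (hf : ContMDiff (𝓡 4) 𝓘(ℝ) ∞ f) (hpos : ∀ x, 0 < f x)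
    (hf₁ : ContMDiff (𝓡 4) 𝓘(ℝ) ∞ f₁) (hf₂ : ContMDiff (𝓡 4) 𝓘(ℝ) ∞ f₂) (x : M) :
    ∀ᶠ ε : ℝ in 𝓝 0,
      connesDensity (perturb (rescale f hf hpos g₀) (rescale f hf hpos g₁) ε) f₁ f₂ x
        = (f x ^ 2)⁻¹ * connesDensity (perturb g₀ g₁ ε) f₁ f₂ x := by
  have hx := mem_extChartAt_target (I := 𝓡 4) x
  have h0 := isLocalMetric_metricCoeff g₀ x
  have h1 := isLocalMetric_metricCoeff g₁ x
  have hd : ∀ᶠ ε : ℝ in 𝓝 0,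
      (metricCoeff (perturb g₀ g₁ ε) x (extChartAt (𝓡 4) x x)).det ≠ 0 := by
    have hc : Continuous fun ε : ℝ => (metricCoeff g₀.inner x (extChartAt (𝓡 4) x x)
        + ε • metricCoeff g₁.inner x (extChartAt (𝓡 4) x x)).det := by
      fun_prop
    simp only [metricCoeff_perturb]
    refine hc.continuousAt.eventually_ne ?_
    simpa using h0.det_ne_zero _ hx
  filter_upwards [hd] with ε hε
  have hsm : ∀ y ∈ (extChartAt (𝓡 4) x).target, ∀ i j,
      ContDiffAt ℝ ∞ (fun z => metricCoeff (perturb g₀ g₁ ε) x z i j) y := by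
    intro y hy i j
    simp only [metricCoeff_perturb, Matrix.add_apply, Matrix.smul_apply, smul_eq_mul]
    exact (h0.contDiffAt y hy i j).add (contDiffAt_const.mul (h1.contDiffAt y hy i j))
  -- the perturbed metric is nondegenerate on a neighbourhood which depends on `ε`
  have hG : IsLocalMetric (metricCoeff (perturb g₀ g₁ ε) x)
      ((extChartAt (𝓡 4) x).target ∩
        {y | (metricCoeff (perturb g₀ g₁ ε) x y).det ≠ 0}) := by
    refine ⟨?_, fun y hy => hsm y hy.1, fun y hy => ?_, fun y hy => hy.2⟩
    · have hcont : ContinuousOn (fun y => (metricCoeff (perturb g₀ g₁ ε) x y).det)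
          (extChartAt (𝓡 4) x).target := fun y hy => by
        have : ContDiffAt ℝ ∞ _ y := (RationalFamily.det (y₀ := y)
          (G := fun _ => metricCoeff (perturb g₀ g₁ ε) x)
          fun i j => .smooth _ (hsm y hy i j)).contDiffAt_zero
        exact this.continuousAt.continuousWithinAt
      exact hcont.isOpen_inter_preimage h0.isOpen isOpen_ne
    · rw [metricCoeff_perturb]
      exact (h0.isSymm y hy.1).add ((h1.isSymm y hy.1).smul ε)
  let σ : E4 → ℝ := fun y => Real.log (f ((extChartAt (𝓡 4) x).symm y)) / 2
  have hexp : ∀ y, Real.exp (2 * σ y) = f ((extChartAt (𝓡 4) x).symm y) := fun y => by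
    rw [mul_div_cancel₀ _ two_ne_zero, Real.exp_log (hpos _)]
  have hσ : ∀ y ∈ (extChartAt (𝓡 4) x).target, ContDiffAt ℝ ∞ σ y := fun y hy =>
    ((contDiffAt_comp_extChartAt_symm hf hy).log (hpos _).ne').div_const 2
  have hmet : metricCoeff (perturb (rescale f hf hpos g₀) (rescale f hf hpos g₁) ε) x
      = conformalMetric σ (metricCoeff (perturb g₀ g₁ ε) x) := by
    funext y
    rw [conformalMetric, hexp]
    ext i j
    have e : ∀ c a b : ℝ, c * a + ε * (c * b) = c * (a + ε * b) := fun c a b => by ring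
    exact e _ _ _
  have key := hG.localConnesDensity_conformal (fun y hy => hσ y hy.1)
    (fun y hy => contDiffAt_comp_extChartAt_symm hf₁ hy.1)
    (fun y hy => contDiffAt_comp_extChartAt_symm hf₂ hy.1) ⟨hx, hε⟩
  rw [hexp, extChartAt_to_inv, ← hmet, inv_pow] at key
  exact key

theorem connesCoeff_rescale (m : ℕ) (g₀ g₁ : RMetric M) {f f₁ f₂ : M → ℝ}
    (hf : ContMDiff (𝓡 4) 𝓘(ℝ) ∞ f) (hpos : ∀ x, 0 < f x)
    (hf₁ : ContMDiff (𝓡 4) 𝓘(ℝ) ∞ f₁) (hf₂ : ContMDiff (𝓡 4) 𝓘(ℝ) ∞ f₂) (x : M) :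
    connesCoeff m (rescale f hf hpos g₀) (rescale f hf hpos g₁) f₁ f₂ x
      = (f x ^ 2)⁻¹ * connesCoeff m g₀ g₁ f₁ f₂ x := by
  rw [connesCoeff, connesCoeff,
    (show _ =ᶠ[𝓝 (0 : ℝ)] _ from
      eventually_connesDensity_rescale g₀ g₁ hf hpos hf₁ hf₂ x).iteratedDeriv_eq,
    iteratedDeriv_const_mul_field, mul_div_assoc]

theorem volumeForm_rescale (o : ManifoldOrientation M) (g : RMetric M) {f : M → ℝ}
    (hf : ContMDiff (𝓡 4) 𝓘(ℝ) ∞ f) (hpos : ∀ x, 0 < f x) (x : M) :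
    volumeForm o (rescale f hf hpos g) x = (f x ^ 2) • volumeForm o g x := by
  rw [volumeForm, volumeForm, smul_smul]
  congr 1
  have : (Matrix.of fun i j =>
      (rescale f hf hpos g).inner x (orientedBasis o x i) (orientedBasis o x j))
      = f x • Matrix.of fun i j => g.inner x (orientedBasis o x i) (orientedBasis o x j) := by
    ext i j
    simp [rescale]
  rw [this, Matrix.det_smul, Fintype.card_fin, show f x ^ 4 = (f x ^ 2) ^ 2 by ring,
    Real.sqrt_mul (by positivity), Real.sqrt_sq (by positivity)]

theorem hasSum_connesCoeff (g₀ g₁ : RMetric M) {f₁ f₂ : M → ℝ}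
    (hf₁ : ContMDiff (𝓡 4) 𝓘(ℝ) ∞ f₁) (hf₂ : ContMDiff (𝓡 4) 𝓘(ℝ) ∞ f₂) (x : M) :
    ∃ δ : ℝ, 0 < δ ∧ ∀ ε : ℝ, |ε| < δ →
      HasSum (fun m : ℕ => connesCoeff m g₀ g₁ f₁ f₂ x * ε ^ m)
        (connesDensity (perturb g₀ g₁ ε) f₁ f₂ x) := by
  have h := (analyticAt_connesDensity g₀ g₁ hf₁ hf₂ x).hasFPowerSeriesAt.eventually_hasSum
  obtain ⟨δ, hδ, h⟩ := Metric.eventually_nhds_iff.1 h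
  refine ⟨δ, hδ, fun ε hε => ?_⟩
  simpa [connesCoeff, mul_comm] using h (y := ε) (by simpa using hε)

end Manifold

end BimetricConformal

theorem mainTheorem2 {M : Type*} [TopologicalSpace M] [ChartedSpace E4 M]
    [IsManifold (𝓡 4) ∞ M] [T2Space M] [CompactSpace M] (o : ManifoldOrientation M)
    (f₁ f₂ : M → ℝ) (hf₁ : ContMDiff (𝓡 4) 𝓘(ℝ) ∞ f₁) (hf₂ : ContMDiff (𝓡 4) 𝓘(ℝ) ∞ f₂) :
    -- the Taylor expansion of `A₄` in `ε`
    (∀ (g₀ g₁ : RMetric M) (x : M), ∃ δ : ℝ, 0 < δ ∧ ∀ ε : ℝ, |ε| < δ →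
      HasSum (fun m : ℕ => connesCoeff m g₀ g₁ f₁ f₂ x * ε ^ m)
        (connesDensity (perturb g₀ g₁ ε) f₁ f₂ x)) ∧
    -- the coefficients have conformal weight `-2`
    (∀ (m : ℕ) (f : M → ℝ) (hf : ContMDiff (𝓡 4) 𝓘(ℝ) ∞ f) (hpos : ∀ x, 0 < f x)
      (g₀ g₁ : RMetric M) (x : M),
      connesCoeff m (rescale f hf hpos g₀) (rescale f hf hpos g₁) f₁ f₂ x
        = (f x ^ 2)⁻¹ * connesCoeff m g₀ g₁ f₁ f₂ x) ∧
    -- the forms `B^m` are bimetric conformal invariants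
    (∀ m : ℕ, IsBimetricConformalInvariant (connesForm o m f₁ f₂)) := by
  refine ⟨fun g₀ g₁ x => hasSum_connesCoeff g₀ g₁ hf₁ hf₂ x,
    fun m f hf hpos g₀ g₁ x => connesCoeff_rescale m g₀ g₁ hf hpos hf₁ hf₂ x,
    fun m f hf hpos g₀ g₁ => ?_⟩
  funext x
  have := (hpos x).ne'
  rw [connesForm, connesForm, connesCoeff_rescale m g₀ g₁ hf hpos hf₁ hf₂, volumeForm_rescale,
    smul_smul]
  congr 1
  field_simp
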